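/- Let $\mathbf F$ be a free group with finite basis $B$. A \emph{($B$-labeled) multi core graph} is a finite graph, possibly disconnected or empty, with directed edges labeled by elements of $B$ (loops and multiple edges allowed), in which every vertex has degree at least two (a loop counting twice) and, for every $b\in B$, at most one incoming and at most one outgoing $b$-edge. A \emph{morphism} of multi core graphs is a graph morphism preserving directions and labels of edges. For a vertex $a$ of $\Gamma$, let $\pi_1^{\mathrm{lab}}(\Gamma,a)\le\mathbf F$ be the subgroup of elements spelled by closed walks at $a$ (edges may be traversed backwards, contributing the inverse letter). A morphism $\eta\colon\Gamma\to\Delta$ is \emph{free} if for every connected component $D$ of $\Delta$, with a vertex $p$ of $D$ and $J=\pi_1^{\mathrm{lab}}(\Delta,p)$, the following holds. Let $\Gamma_1,\dots,\Gamma_\ell$ be the components of $\Gamma$ mapped into $D$ ($\ell\ge 0$), choose a vertex $a_i$ of $\Gamma_i$ and an element $u_i\in\mathbf F$ spelled by a walk in $\Delta$ from $p$ to $\eta(a_i)$, and put $H_i=u_i\,\pi_1^{\mathrm{lab}}(\Gamma_i,a_i)\,u_i^{-1}\le J$. Then there are $j_1,\dots,j_\ell\in J$ and a subgroup $K\le J$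 such that $J$ is the internal free product $J=\bigl(\ast_{i=1}^{\ell} j_iH_ij_i^{-1}\bigr)\ast K$. (This does not depend on the choices of $p$, $a_i$, $u_i$.) A morphism $\eta\colon\Gamma\to\Delta$ is \emph{algebraic} if, whenever $\eta=\eta_2\circ\eta_1$ with morphisms $\eta_1\colon\Gamma\to\Sigma$, $\eta_2\colon\Sigma\to\Delta$ of multi core graphs and $\eta_2$ free, $\eta_2$ is an isomorphism. \textbf{Theorem.} Let $\eta\colon\Gamma\to\Delta$ be a morphism of multi core graphs. Then there is a decomposition $\Gamma\xrightarrow{\varphi}\Sigma\xrightarrow{\psi}\Delta$, $\eta=\psi\circ\varphi$, with $\varphi$ algebraic and $\psi$ free. It is unique: if $\Gamma\xrightarrow{\varphi'}\Sigma'\xrightarrow{\psi'}\Delta$ is another decomposition of $\eta$ with $\varphi'$ algebraic and $\psi'$ free, then there is an isomorphism $i\colon\Sigma\to\Sigma'$ with $i\circ\varphi=\varphi'$ and $\psi'\circ i=\psi$. Moreover, it is universal: for every decomposition $\Gamma\xrightarrow{\varphi'}\Sigma'\xrightarrow{\psi'}\Delta$ of $\eta$, \begin{enumerate} \item if $\varphi'$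 is algebraic, there is a morphism $\theta\colon\Sigma'\to\Sigma$ with $\varphi=\theta\circ\varphi'$ and $\psi'=\psi\circ\theta$; \item if $\psi'$ is free, there is a morphism $\theta'\colon\Sigma\to\Sigma'$ with $\psi=\psi'\circ\theta'$ and $\varphi'=\theta'\circ\varphi$. \end{enumerate} -/

import Mathlib

open CategoryTheory

universe u v

/-- A `B`-labeled multi core graph: a finite graph (multiple edges and loops allowed, possibly
disconnected or empty) whose edges are directed and labeled by elements of `B`, without leaves or
isolated vertices, and such that at every vertex and for every `b : B` there is at most one
outgoing and at most one incoming `b`-edge. -/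
structure MultiCoreGraph (B : Type v) where
  V : Type u
  E : Type u
  finite_V : Finite V
  finite_E : Finite E
  src : E → V
  tgt : E → V
  label : E → B
  out_unique : ∀ e e' : E, src e = src e' → label e = label e' → e = e'
  in_unique : ∀ e e' : E, tgt e = tgt e' → label e = label e' → e = e'
  /-- Every vertex has degree at least two, where a loop counts twice. -/
  two_le_degree : ∀ w : V, 2 ≤ Nat.card {e : E // src e = w} + Nat.card {e : E // tgt e = w}

namespace MultiCoreGraph

variable {B : Type v}

/-- A morphism of `B`-labeled multi core graphs: a graph morphism that preserves the orientation
and the label of every edge. -/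
@[ext]
structure Hom (Γ Δ : MultiCoreGraph.{u} B) where
  onV : Γ.V → Δ.V
  onE : Γ.E → Δ.E
  src_comm : ∀ e, Δ.src (onE e) = onV (Γ.src e)
  tgt_comm : ∀ e, Δ.tgt (onE e) = onV (Γ.tgt e)
  label_comm : ∀ e, Δ.label (onE e) = Γ.label e

instance : Category (MultiCoreGraph.{u} B) where
  Hom Γ Δ := Hom Γ Δ
  id _ := ⟨id, id, fun _ => rfl, fun _ => rfl, fun _ => rfl⟩
  comp f g :=
    { onV := g.onV ∘ f.onV
      onE := g.onE ∘ f.onE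
      src_comm := fun e => by simp [g.src_comm, f.src_comm]
      tgt_comm := fun e => by simp [g.tgt_comm, f.tgt_comm]
      label_comm := fun e => by simp [g.label_comm, f.label_comm] }

/-- `Γ.Reads a g b`: some walk from `a` to `b` in `Γ`, which may traverse edges in both directions,
spells the element `g` of the free group on `B`; a `b`-edge contributes the factor `b` when
traversed forwards and `b⁻¹` when traversed backwards. -/
inductive Reads (Γ : MultiCoreGraph.{u} B) (a : Γ.V) : FreeGroup B → Γ.V → Prop
  | nil : Γ.Reads a 1 a
  | forward {g : FreeGroup B} (e : Γ.E) :
      Γ.Reads a g (Γ.src e) → Γ.Reads a (g * FreeGroup.of (Γ.label e)) (Γ.tgt e)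
  | backward {g : FreeGroup B} (e : Γ.E) :
      Γ.Reads a g (Γ.tgt e) → Γ.Reads a (g * (FreeGroup.of (Γ.label e))⁻¹) (Γ.src e)

theorem Reads.trans {Γ : MultiCoreGraph.{u} B} {a b c : Γ.V} {g h : FreeGroup B}
    (hg : Γ.Reads a g b) (hh : Γ.Reads b h c) : Γ.Reads a (g * h) c := by
  induction hh with
  | nil => simpa using hg
  | forward e _ ih => rw [← mul_assoc]; exact ih.forward e
  | backward e _ ih => rw [← mul_assoc]; exact ih.backward e

theorem Reads.symm {Γ : MultiCoreGraph.{u} B} {a b : Γ.V} {g : FreeGroup B}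
    (hg : Γ.Reads a g b) : Γ.Reads b g⁻¹ a := by
  induction hg with
  | nil => simpa using Reads.nil
  | forward e _ ih =>
    have h := (Reads.nil (Γ := Γ)).backward e
    simpa using h.trans ih
  | backward e _ ih =>
    have h := (Reads.nil (Γ := Γ)).forward e
    simpa using h.trans ih

theorem Reads.map {Γ Δ : MultiCoreGraph.{u} B} (η : Γ ⟶ Δ) {a b : Γ.V} {g : FreeGroup B}
    (hg : Γ.Reads a g b) : Δ.Reads (η.onV a) g (η.onV b) := by
  induction hg with
  | nil => exact Reads.nil
  | forward e _ ih =>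
    rw [← η.src_comm] at ih
    have h := ih.forward (η.onE e)
    rwa [η.label_comm, η.tgt_comm] at h
  | backward e _ ih =>
    rw [← η.tgt_comm] at ih
    have h := ih.backward (η.onE e)
    rwa [η.label_comm, η.src_comm] at h

/-- The labeled fundamental group of `Γ` at the vertex `a`, as a subgroup of the free group on
`B`. -/
def piOne (Γ : MultiCoreGraph.{u} B) (a : Γ.V) : Subgroup (FreeGroup B) where
  carrier := {g | Γ.Reads a g a}
  one_mem' := Reads.nil
  mul_mem' := Reads.trans
  inv_mem' := Reads.symm

/-- Two vertices are equivalent when they are joined by a walk. -/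
def connSetoid (Γ : MultiCoreGraph.{u} B) : Setoid Γ.V where
  r a b := ∃ g, Γ.Reads a g b
  iseqv :=
    { refl := fun _ => ⟨1, Reads.nil⟩
      symm := fun ⟨_, h⟩ => ⟨_, h.symm⟩
      trans := fun ⟨_, h⟩ ⟨_, h'⟩ => ⟨_, h.trans h'⟩ }

/-- The connected components of a multi core graph. -/
def Component (Γ : MultiCoreGraph.{u} B) : Type u := Quotient Γ.connSetoid

/-- The connected component of a vertex. -/
def component (Γ : MultiCoreGraph.{u} B) (a : Γ.V) : Γ.Component := Quotient.mk Γ.connSetoid a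

/-- The map that a morphism induces on connected components. -/
def mapComponent {Γ Δ : MultiCoreGraph.{u} B} (η : Γ ⟶ Δ) : Γ.Component → Δ.Component :=
  Quotient.map η.onV fun _ _ ⟨_, h⟩ => ⟨_, h.map η⟩

end MultiCoreGraph

/-- The conjugate subgroup `g H g⁻¹`. -/
def Subgroup.conjBy {G : Type*} [Group G] (g : G) (H : Subgroup G) : Subgroup G :=
  H.map (MulAut.conj g).toMonoidHom

/-- The subgroup `J` is the internal free product of the family of subgroups `H`: the subgroups
generate `J`, and the canonical map from their abstract free product is injective. -/
def Subgroup.IsInternalFreeProduct {G : Type*} [Group G] {ι : Type*} (H : ι → Subgroup G)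
    (J : Subgroup G) : Prop :=
  Function.Injective (Monoid.CoprodI.lift fun i => (H i).subtype) ∧ ⨆ i, H i = J

/-- `J` is a free extension of the family (multiset) of subgroups `H i ≤ J`: it decomposes as the
internal free product of conjugates `j i * H i * (j i)⁻¹` with `j i ∈ J`, one for each `i`, and of
one further subgroup `K`. -/
def Subgroup.IsFreeExtension {G : Type*} [Group G] {ι : Type*} (H : ι → Subgroup G)
    (J : Subgroup G) : Prop :=
  ∃ (j : ι → G) (K : Subgroup G), (∀ i, j i ∈ J) ∧ K ≤ J ∧
    Subgroup.IsInternalFreeProduct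
      (fun o : Option ι => o.elim K fun i => Subgroup.conjBy (j i) (H i)) J

namespace MultiCoreGraph

variable {B : Type v}

/-- A morphism `η : Γ ⟶ Δ` is free if, for each connected component `D` of `Δ` (given through a
vertex `p` in it), the group `piOne Δ p` is a free extension of the subgroups that correspond under
`η` to the components of `Γ` lying over `D`. The subgroup of a component `c` is
`u c * piOne Γ (a c) * (u c)⁻¹`, where `a c` is a vertex of `c` and `u c` is spelled by a walk in
`Δ` from `p` to the image of `a c`. -/
def IsFree {Γ Δ : MultiCoreGraph.{u} B} (η : Γ ⟶ Δ) : Prop :=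
  ∀ p : Δ.V, ∃ (a : {c : Γ.Component // mapComponent η c = Δ.component p} → Γ.V)
    (u : {c : Γ.Component // mapComponent η c = Δ.component p} → FreeGroup B),
    (∀ c, Γ.component (a c) = c.1) ∧ (∀ c, Δ.Reads p (u c) (η.onV (a c))) ∧
    Subgroup.IsFreeExtension (fun c => Subgroup.conjBy (u c) (Γ.piOne (a c))) (Δ.piOne p)

/-- A morphism `η` is algebraic if in every decomposition of `η` whose last morphism is free, that
last morphism is an isomorphism. -/
def IsAlgebraic {Γ Δ : MultiCoreGraph.{u} B} (η : Γ ⟶ Δ) : Prop :=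
  ∀ (S : MultiCoreGraph.{u} B) (η₁ : Γ ⟶ S) (η₂ : S ⟶ Δ), η₁ ≫ η₂ = η → IsFree η₂ → IsIso η₂

end MultiCoreGraph

/-! Two facts about free morphisms carry the theorem: they are stable under pullback, and they
cannot decrease a suitable size from source to target unless they are isomorphisms.

Universality. Multi core graphs have pullbacks: the fiber product of graphs with everything off its
core removed. Let `φ ≫ ψ = φ' ≫ ψ'` with `φ` algebraic and `ψ'` free. The pullback of `ψ'` along `ψ`
is again free (`IsFree.pullbackSnd`), and `φ` factors through it, so algebraicity makes it an
isomorphism; its inverse followed by the other projection is the required map over `Δ`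
(`IsAlgebraic.exists_hom`), and the only one (`IsAlgebraic.hom_unique`). Both universal properties
and the uniqueness of the decomposition follow formally.

Stability under pullback is the Kurosh subgroup theorem (`IsInternalFreeProduct.exists_kurosh`):
fundamental groups of the pullback are intersections of conjugates, and its components over a given
one inject into the Kurosh factors.

Existence. Give a component of rank `r` the weight `2 * r - 1`. If components of ranks `r_1, ...,
r_ℓ` lie freely over one of rank `R`, then `∑ r_i ≤ R`, so the weights above sum to at most `2 * R -
1`, with equality only if `ℓ = 1` and the complementary factor is trivial. Thus a free morphism
whose source weighs at least as much as its target is an isomorphism (`IsFree.isIso_of_weight_le`).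
Among the decompositions of `η` with free second morphism, one with a middle graph of least weight
has an algebraic first morphism, because free morphisms compose. -/

namespace MultiCoreGraph

/-! ### Walks that spell words, and unique path lifting -/

section Walks

variable {B : Type v}

/-- `Γ.Step a ℓ b`: the letter `ℓ` is spelled by an edge leading from `a` to `b`; the letter
`(x, false)` stands for `x⁻¹` and is spelled by an `x`-edge that is traversed backwards. -/
def Step (Γ : MultiCoreGraph.{u} B) (a : Γ.V) (l : B × Bool) (b : Γ.V) : Prop :=
  ∃ e, Γ.label e = l.1 ∧ Γ.src e = (if l.2 then a else b) ∧ Γ.tgt e = (if l.2 then b else a)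

/-- `Γ.Walk a L b`: the word `L` is spelled by a walk from `a` to `b`. -/
def Walk (Γ : MultiCoreGraph.{u} B) : Γ.V → List (B × Bool) → Γ.V → Prop
  | a, [], b => a = b
  | a, l :: L, b => ∃ c, Γ.Step a l c ∧ Γ.Walk c L b

variable {Γ Δ : MultiCoreGraph.{u} B}

theorem Step.flip {a b : Γ.V} {l : B × Bool} (h : Γ.Step a l b) : Γ.Step b (l.1, !l.2) a := by
  obtain ⟨x, s⟩ := l
  cases s <;> simpa [Step] using h

theorem Step.unique {a b c : Γ.V} {l : B × Bool} (h : Γ.Step a l b) (h' : Γ.Step a l c) :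
    b = c := by
  obtain ⟨x, s⟩ := l
  obtain ⟨e, h1, h2, h3⟩ := h
  obtain ⟨e', h1', h2', h3'⟩ := h'
  cases s
  · simp only [Bool.false_eq_true, if_false] at h2 h3 h2' h3'
    rw [← h2, ← h2', Γ.in_unique e e' (h3.trans h3'.symm) (h1.trans h1'.symm)]
  · simp only [if_true] at h2 h3 h2' h3'
    rw [← h3, ← h3', Γ.out_unique e e' (h2.trans h2'.symm) (h1.trans h1'.symm)]

theorem Step.map (η : Γ ⟶ Δ) {a b : Γ.V} {l : B × Bool} (h : Γ.Step a l b) :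
    Δ.Step (η.onV a) l (η.onV b) := by
  obtain ⟨e, h1, h2, h3⟩ := h
  refine ⟨η.onE e, (η.label_comm e).trans h1, ?_, ?_⟩
  · rw [η.src_comm, h2]; split <;> rfl
  · rw [η.tgt_comm, h3]; split <;> rfl

theorem Step.reads {a b : Γ.V} {l : B × Bool} (h : Γ.Step a l b) :
    Γ.Reads a (FreeGroup.mk [l]) b := by
  obtain ⟨x, s⟩ := l
  obtain ⟨e, rfl, h2, h3⟩ := h
  cases s
  · simp only [Bool.false_eq_true, if_false] at h2 h3
    have := (Reads.nil (Γ := Γ)).backward e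
    rw [one_mul, h2, h3] at this
    exact this
  · simp only [if_true] at h2 h3
    have := (Reads.nil (Γ := Γ)).forward e
    rw [one_mul, h2, h3] at this
    exact this

theorem Walk.append {a b c : Γ.V} {L M : List (B × Bool)} (h : Γ.Walk a L b)
    (h' : Γ.Walk b M c) : Γ.Walk a (L ++ M) c := by
  induction L generalizing a with
  | nil => cases h; exact h'
  | cons l L ih => exact ⟨h.choose, h.choose_spec.1, ih h.choose_spec.2⟩

theorem walk_append_iff {a c : Γ.V} {L M : List (B × Bool)} :
    Γ.Walk a (L ++ M) c ↔ ∃ b, Γ.Walk a L b ∧ Γ.Walk b M c := by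
  refine ⟨fun h => ?_, fun ⟨b, h, h'⟩ => h.append h'⟩
  induction L generalizing a with
  | nil => exact ⟨a, rfl, h⟩
  | cons l L ih =>
    obtain ⟨d, h1, h2⟩ := h
    obtain ⟨b, h3, h4⟩ := ih h2
    exact ⟨b, ⟨d, h1, h3⟩, h4⟩

theorem Step.walk {a b : Γ.V} {l : B × Bool} (h : Γ.Step a l b) : Γ.Walk a [l] b := ⟨b, h, rfl⟩

theorem Walk.symm {a b : Γ.V} {L : List (B × Bool)} (h : Γ.Walk a L b) :
    Γ.Walk b (FreeGroup.invRev L) a := by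
  induction L generalizing a with
  | nil => exact Eq.symm h
  | cons l L ih =>
    obtain ⟨c, h1, h2⟩ := h
    rw [FreeGroup.invRev_cons]
    exact (ih h2).append h1.flip.walk

theorem Walk.reads {a b : Γ.V} {L : List (B × Bool)} (h : Γ.Walk a L b) :
    Γ.Reads a (FreeGroup.mk L) b := by
  induction L generalizing a with
  | nil => cases h; exact Reads.nil
  | cons l L ih =>
    obtain ⟨c, h1, h2⟩ := h
    exact h1.reads.trans (ih h2)

theorem Walk.unique {a b c : Γ.V} {L : List (B × Bool)} (h : Γ.Walk a L b)
    (h' : Γ.Walk a L c) : b = c := by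
  induction L generalizing a with
  | nil => exact Eq.trans (Eq.symm h) h'
  | cons l L ih =>
    obtain ⟨d, h1, h2⟩ := h
    obtain ⟨d', h1', h2'⟩ := h'
    obtain rfl := h1.unique h1'
    exact ih h2 h2'

/-- By determinism, a cancelling pair of letters walks along an edge and back along the same edge,
so deleting it keeps the endpoints. Hence group elements can always be read along their reduced
words. -/
theorem Walk.red {a b : Γ.V} {L M : List (B × Bool)} (h : Γ.Walk a L b)
    (hr : FreeGroup.Red L M) : Γ.Walk a M b := by
  induction hr with
  | refl => exact h
  | tail _ hs ih =>
    cases hs with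
    | not =>
      obtain ⟨c, h1, d, h2, d', h3, h4⟩ := walk_append_iff.1 ih
      obtain rfl := h2.flip.unique h3
      exact h1.append h4

theorem Reads.exists_walk {a b : Γ.V} {g : FreeGroup B} (h : Γ.Reads a g b) :
    ∃ L, FreeGroup.mk L = g ∧ Γ.Walk a L b := by
  induction h with
  | nil => exact ⟨[], rfl, rfl⟩
  | forward e _ ih =>
    obtain ⟨L, rfl, h⟩ := ih
    exact ⟨L ++ [(Γ.label e, true)], rfl, h.append (Step.walk ⟨e, rfl, rfl, rfl⟩)⟩
  | backward e _ ih =>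
    obtain ⟨L, rfl, h⟩ := ih
    exact ⟨L ++ [(Γ.label e, false)], rfl, h.append (Step.walk ⟨e, rfl, rfl, rfl⟩)⟩

theorem Reads.walk {a b : Γ.V} {L : List (B × Bool)} (h : Γ.Reads a (FreeGroup.mk L) b)
    (hL : FreeGroup.IsReduced L) : Γ.Walk a L b := by
  classical
  obtain ⟨M, hM, hw⟩ := h.exists_walk
  have := hw.red FreeGroup.reduce.red
  rwa [FreeGroup.reduce.sound hM, hL.reduce_eq] at this

theorem Reads.walk_toWord [DecidableEq B] {a b : Γ.V} {g : FreeGroup B} (h : Γ.Reads a g b) :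
    Γ.Walk a g.toWord b :=
  Reads.walk (by rwa [FreeGroup.mk_toWord]) FreeGroup.isReduced_toWord

theorem Reads.unique {a b c : Γ.V} {g : FreeGroup B} (h : Γ.Reads a g b)
    (h' : Γ.Reads a g c) : b = c := by
  classical
  exact h.walk_toWord.unique h'.walk_toWord

theorem mem_piOne {a : Γ.V} {g : FreeGroup B} : g ∈ Γ.piOne a ↔ Γ.Reads a g a := Iff.rfl

theorem component_eq_iff {a b : Γ.V} : Γ.component a = Γ.component b ↔ ∃ g, Γ.Reads a g b :=
  Quotient.eq (r := Γ.connSetoid)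

theorem mapComponent_component (η : Γ ⟶ Δ) (a : Γ.V) :
    mapComponent η (Γ.component a) = Δ.component (η.onV a) := rfl

theorem exists_component_eq (c : Γ.Component) : ∃ a, Γ.component a = c := Quotient.exists_rep c

theorem mem_conjBy {G : Type*} [Group G] {g x : G} {H : Subgroup G} :
    x ∈ Subgroup.conjBy g H ↔ g⁻¹ * x * g ∈ H := by
  constructor
  · rintro ⟨y, hy, rfl⟩
    simpa [mul_assoc] using hy
  · intro h
    exact ⟨_, h, by simp [mul_assoc]⟩

theorem mem_conjBy_piOne {a : Γ.V} {g x : FreeGroup B} :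
    x ∈ Subgroup.conjBy g (Γ.piOne a) ↔ Γ.Reads a (g⁻¹ * x * g) a := mem_conjBy

end Walks

/-! ### Non-backtracking closed walks from the degree condition -/

section Faces

variable {B : Type v} (Γ : MultiCoreGraph.{u} B)

/-- The starting point of a dart, an edge together with the direction in which it is traversed. -/
def dartSrc (d : Γ.E × Bool) : Γ.V := if d.2 then Γ.src d.1 else Γ.tgt d.1

theorem exists_perm_ne (α : Type*) [Finite α] (h : 2 ≤ Nat.card α) :
    ∃ σ : Equiv.Perm α, ∀ a, σ a ≠ a := by
  obtain ⟨n, hn⟩ : ∃ n, Nat.card α = n + 2 := ⟨Nat.card α - 2, by omega⟩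
  let e := Finite.equivFinOfCardEq hn
  refine ⟨(e.trans (finRotate (n + 2))).trans e.symm, fun a h => ?_⟩
  have h1 : finRotate (n + 2) (e a) = e a := by
    simpa using congrArg e h
  rw [finRotate_apply] at h1
  simp at h1

theorem two_le_card_darts (w : Γ.V) : 2 ≤ Nat.card {d : Γ.E × Bool // Γ.dartSrc d = w} := by
  have := Γ.finite_E
  refine (Γ.two_le_degree w).trans ?_
  rw [← Nat.card_sum]
  refine Nat.card_le_card_of_injective
    (Sum.elim (fun e => ⟨(e.1, true), e.2⟩) (fun e => ⟨(e.1, false), e.2⟩)) ?_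
  rintro (⟨a, ha⟩ | ⟨a, ha⟩) (⟨b, hb⟩ | ⟨b, hb⟩) h <;>
    simpa using congrArg Subtype.val h

/-- A permutation of the darts that sends each dart to one continuing it without backtracking. -/
theorem exists_continuation : ∃ σ : Equiv.Perm (Γ.E × Bool), ∀ d,
    Γ.dartSrc (σ d) = Γ.dartSrc (d.1, !d.2) ∧ σ d ≠ (d.1, !d.2) := by
  have := Γ.finite_E
  choose τ hτ using fun w => exists_perm_ne _ (Γ.two_le_card_darts w)
  -- Glue the fixed-point-free permutations of the darts at the single vertices. Reversing a dart
  -- and then applying the result never yields the reversed dart itself.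
  let τ' : Equiv.Perm (Γ.E × Bool) :=
    ((Equiv.sigmaFiberEquiv Γ.dartSrc).symm.trans (Equiv.sigmaCongrRight τ)).trans
      (Equiv.sigmaFiberEquiv Γ.dartSrc)
  have h (d) : τ' d = (τ (Γ.dartSrc d) ⟨d, rfl⟩).1 := rfl
  let ρ : Equiv.Perm (Γ.E × Bool) := Equiv.prodCongr (Equiv.refl _) Equiv.boolNot
  refine ⟨ρ.trans τ', fun d => ⟨?_, fun hd => ?_⟩⟩
  · exact (τ (Γ.dartSrc (ρ d)) ⟨ρ d, rfl⟩).2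
  · exact hτ (Γ.dartSrc (ρ d)) ⟨ρ d, rfl⟩ (Subtype.ext hd)

variable {Γ}

/-- Every edge of a multi core graph starts a reduced closed walk. -/
theorem Step.exists_closed_walk {a b : Γ.V} {l : B × Bool} (h : Γ.Step a l b) :
    ∃ L, FreeGroup.IsReduced (l :: L) ∧ Γ.Walk a (l :: L) a := by
  have := Γ.finite_E
  obtain ⟨σ, hσ⟩ := Γ.exists_continuation
  let w (d : Γ.E × Bool) : B × Bool := (Γ.label d.1, d.2)
  have hstep (d) : Γ.Step (Γ.dartSrc d) (w d) (Γ.dartSrc (σ d)) := by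
    rw [(hσ d).1]
    refine ⟨d.1, rfl, ?_, ?_⟩ <;> rcases d with ⟨e, _ | _⟩ <;> rfl
  -- If consecutive letters cancelled, determinism would force the two darts to be reverses of each
  -- other, which `σ` excludes.
  have hred (d) : (w d).1 = (w (σ d)).1 → (w d).2 = (w (σ d)).2 := by
    intro h1
    by_contra h2
    apply (hσ d).2
    have h3 := (hσ d).1
    rcases d with ⟨e, s⟩
    rcases hd : σ (e, s) with ⟨e', s'⟩
    rw [hd] at h1 h2 h3
    have h4 : s' = !s := by cases s <;> cases s' <;> simp_all [w]
    subst h4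
    cases s
    · rw [Γ.out_unique e' e (by simpa [dartSrc] using h3) h1.symm]
    · rw [Γ.in_unique e' e (by simpa [dartSrc] using h3) h1.symm]
  have hw (n : ℕ) : ∀ d, Γ.Walk (Γ.dartSrc d) ((List.range n).map fun i => w ((σ ^ i) d))
      (Γ.dartSrc ((σ ^ n) d)) := by
    induction n with
    | zero => intro d; rfl
    | succ n ih =>
      intro d
      rw [List.range_succ, List.map_append]
      refine (ih d).append (Step.walk ?_)
      rw [pow_succ']
      exact hstep _
  have hr (n : ℕ) : ∀ d, FreeGroup.IsReduced ((List.range n).map fun i => w ((σ ^ i) d)) := by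
    intro d
    rw [FreeGroup.IsReduced, List.isChain_map, List.isChain_iff_getElem]
    intro i hi
    simp only [List.getElem_range]
    rw [pow_succ']
    exact hred _
  obtain ⟨d, rfl, hd⟩ : ∃ d, Γ.dartSrc d = a ∧ w d = l := by
    obtain ⟨x, s⟩ := l
    obtain ⟨e, rfl, h2, h3⟩ := h
    refine ⟨(e, s), ?_, rfl⟩
    cases s <;> simpa [dartSrc]
  -- Iterating `σ` as often as its order returns to the initial dart, so the walk closes up.
  obtain ⟨n, hn, hσn⟩ := (isOfFinOrder_of_finite σ).exists_pow_eq_one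
  obtain ⟨m, rfl⟩ := Nat.exists_eq_succ_of_ne_zero hn.ne'
  have h1 := hw (m + 1) d
  have h2 := hr (m + 1) d
  rw [show σ ^ (m + 1) = 1 from hσn] at h1
  rw [List.range_succ_eq_map, List.map_cons, pow_zero, Equiv.Perm.one_apply, hd] at h1 h2
  exact ⟨_, h2, h1⟩

theorem exists_step_ne (a : Γ.V) (m : B × Bool) : ∃ l, l ≠ m ∧ ∃ b, Γ.Step a l b := by
  have := Γ.finite_E
  obtain ⟨⟨d, hd⟩, ⟨d', hd'⟩, hne⟩ := Finite.one_lt_card_iff_nontrivial.1 (Γ.two_le_card_darts a)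
  have key (d : Γ.E × Bool) (hd : Γ.dartSrc d = a) : ∃ b, Γ.Step a (Γ.label d.1, d.2) b := by
    subst hd
    rcases d with ⟨e, _ | _⟩ <;> exact ⟨_, e, rfl, rfl, rfl⟩
  by_cases h : (Γ.label d.1, d.2) = m
  · refine ⟨_, fun h' => hne ?_, key d' hd'⟩
    obtain ⟨e, s⟩ := d
    obtain ⟨e', s'⟩ := d'
    obtain ⟨hl, rfl⟩ := Prod.mk.injEq .. ▸ h'.trans h.symm
    have hs := hd.trans hd'.symm
    refine Subtype.ext (Prod.ext ?_ rfl)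
    cases s'
    · exact Γ.in_unique e e' hs hl.symm
    · exact Γ.out_unique e e' hs hl.symm
  · exact ⟨_, h, key d hd⟩

theorem exists_step (a : Γ.V) : ∃ l b, Γ.Step a l b := by
  obtain ⟨⟨⟨d, hd⟩⟩⟩ := Nat.card_pos_iff.1 (zero_lt_two.trans_le (Γ.two_le_card_darts a))
  obtain ⟨l, -, b, h⟩ := exists_step_ne a (Γ.label d.1, true)
  exact ⟨l, b, h⟩

theorem piOne_ne_bot (a : Γ.V) : Γ.piOne a ≠ ⊥ := by
  classical
  obtain ⟨l, b, h⟩ := exists_step a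
  obtain ⟨L, hL, hw⟩ := h.exists_closed_walk
  intro h'
  have h1 : FreeGroup.mk (l :: L) ∈ Γ.piOne a := hw.reads
  rw [h', Subgroup.mem_bot] at h1
  have h2 := congrArg FreeGroup.toWord h1
  rw [FreeGroup.toWord_mk, hL.reduce_eq, FreeGroup.toWord_one] at h2
  simp at h2

end Faces

end MultiCoreGraph

namespace Subgroup

/-! ### Internal free products through their universal property -/

section FreeProducts

universe w z z' t

variable {G : Type w} [Group G] {ι : Type z} {κ : Type z'}

theorem IsInternalFreeProduct.exists_extension {H : ι → Subgroup G} {J : Subgroup G}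
    (h : IsInternalFreeProduct H J) {N : Type t} [Monoid N] (f : ∀ i, H i →* N) :
    ∃ Φ : J →* N, ∀ i x (hx : x ∈ H i) (hJ : x ∈ J), Φ ⟨x, hJ⟩ = f i ⟨x, hx⟩ := by
  obtain ⟨hinj, hsup⟩ := h
  let e := MonoidHom.ofInjective hinj
  have hr : J ≤ (Monoid.CoprodI.lift fun i => (H i).subtype).range := by
    rw [Monoid.CoprodI.range_eq_iSup, ← hsup]
    simp
  refine ⟨((Monoid.CoprodI.lift f).comp e.symm.toMonoidHom).comp (Subgroup.inclusion hr),
    fun i x hx hJ => ?_⟩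
  have : e.symm (Subgroup.inclusion hr ⟨x, hJ⟩) =
      Monoid.CoprodI.of (M := fun i => H i) (i := i) ⟨x, hx⟩ := by
    rw [MulEquiv.symm_apply_eq]
    ext
    simp [e, MonoidHom.ofInjective_apply]
  simp only [MonoidHom.comp_apply, MulEquiv.coe_toMonoidHom]
  erw [this]
  simp

/-- `Φ` is a left inverse of the canonical map from the abstract free product to `J`, as can be
tested on the factors. -/
theorem isInternalFreeProduct_of_hom {H : ι → Subgroup G} {J : Subgroup G}
    (hJ : ⨆ i, H i = J) (Φ : J →* Monoid.CoprodI fun i => H i)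
    (hΦ : ∀ i x (hx : x ∈ H i) (hJ : x ∈ J),
      Φ ⟨x, hJ⟩ = Monoid.CoprodI.of (M := fun i => H i) (i := i) ⟨x, hx⟩) :
    IsInternalFreeProduct H J := by
  refine ⟨?_, hJ⟩
  have hle (i) : H i ≤ J := hJ ▸ le_iSup H i
  let l : (Monoid.CoprodI fun i => H i) →* J :=
    Monoid.CoprodI.lift fun i => Subgroup.inclusion (hle i)
  have h1 : Φ.comp l = MonoidHom.id _ := by
    ext i ⟨x, hx⟩
    simp only [l, MonoidHom.comp_apply, Monoid.CoprodI.lift_of, MonoidHom.id_apply]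
    exact hΦ i x hx _
  have h2 : Monoid.CoprodI.lift (fun i => (H i).subtype) = J.subtype.comp l := by
    ext i ⟨x, hx⟩
    simp [l]
  rw [h2, MonoidHom.coe_comp]
  refine J.subtype_injective.comp (Function.LeftInverse.injective (g := Φ) fun x => ?_)
  exact DFunLike.congr_fun h1 x

/-- Testing against the abstract free product itself suffices, which explains the universe of `N`.
All later decompositions are obtained by extending homomorphisms, without normal forms of words. -/
theorem isInternalFreeProduct_option {K : Subgroup G} {H : ι → Subgroup G} {J : Subgroup G}
    (hK : K ≤ J) (hH : ∀ i, H i ≤ J) (hJ : J ≤ K ⊔ ⨆ i, H i)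
    (hext : ∀ (N : Type (max w z)) [Group N] (f : ∀ i, H i →* N) (fK : K →* N),
      ∃ Φ : J →* N, (∀ i x (hx : x ∈ H i) (hJ : x ∈ J), Φ ⟨x, hJ⟩ = f i ⟨x, hx⟩) ∧
        ∀ x (hx : x ∈ K) (hJ : x ∈ J), Φ ⟨x, hJ⟩ = fK ⟨x, hx⟩) :
    IsInternalFreeProduct (fun o : Option ι => o.elim K H) J := by
  obtain ⟨Φ, h1, h2⟩ := hext (Monoid.CoprodI fun o : Option ι => (o.elim K H : Subgroup G))
    (fun i => Monoid.CoprodI.of (M := fun o : Option ι => (o.elim K H : Subgroup G))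
      (i := some i))
    (Monoid.CoprodI.of (M := fun o : Option ι => (o.elim K H : Subgroup G)) (i := none))
  refine isInternalFreeProduct_of_hom ?_ Φ ?_
  · rw [iSup_option]
    exact le_antisymm (sup_le hK (iSup_le hH)) hJ
  · rintro (_ | i) x hx hxJ
    · exact h2 x hx hxJ
    · exact h1 i x hx hxJ

theorem IsInternalFreeProduct.exists_extension_option {K : Subgroup G} {H : ι → Subgroup G}
    {J : Subgroup G} (h : IsInternalFreeProduct (fun o : Option ι => o.elim K H) J)
    {N : Type t} [Monoid N] (f : ∀ i, H i →* N) (fK : K →* N) :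
    ∃ Φ : J →* N, (∀ i x (hx : x ∈ H i) (hJ : x ∈ J), Φ ⟨x, hJ⟩ = f i ⟨x, hx⟩) ∧
      ∀ x (hx : x ∈ K) (hJ : x ∈ J), Φ ⟨x, hJ⟩ = fK ⟨x, hx⟩ := by
  obtain ⟨Φ, hΦ⟩ := h.exists_extension (N := N) (fun o => match o with
    | none => fK
    | some i => f i)
  exact ⟨Φ, fun i => hΦ (some i), hΦ none⟩

theorem IsInternalFreeProduct.le {H : ι → Subgroup G} {J : Subgroup G}
    (h : IsInternalFreeProduct H J) (i : ι) : H i ≤ J := h.2 ▸ le_iSup H i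

theorem IsInternalFreeProduct.map {G' : Type*} [Group G'] {H : ι → Subgroup G} {J : Subgroup G}
    (h : IsInternalFreeProduct H J) (f : G →* G') (hf : Function.Injective f) :
    IsInternalFreeProduct (fun i => (H i).map f) (J.map f) := by
  obtain ⟨Φ, hΦ⟩ := h.exists_extension
    (fun i => (Monoid.CoprodI.of (M := fun i => (H i).map f) (i := i)).comp (f.subgroupMap (H i)))
  refine isInternalFreeProduct_of_hom (by rw [← Subgroup.map_iSup, h.2])
    (Φ.comp (J.equivMapOfInjective f hf).symm.toMonoidHom) ?_
  rintro i _ ⟨x, hx, rfl⟩ hJ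
  have : (J.equivMapOfInjective f hf).symm ⟨f x, hJ⟩ = ⟨x, h.le i hx⟩ := by
    rw [MulEquiv.symm_apply_eq]
    rfl
  simp only [MonoidHom.comp_apply, MulEquiv.coe_toMonoidHom, this]
  exact hΦ i x hx _

theorem IsInternalFreeProduct.subgroupOf {H : ι → Subgroup G} {J : Subgroup G}
    (h : IsInternalFreeProduct H J) :
    IsInternalFreeProduct (fun i => (H i).subgroupOf J) ⊤ := by
  obtain ⟨Φ, hΦ⟩ := h.exists_extension
    (fun i => (Monoid.CoprodI.of (M := fun i => (H i).subgroupOf J) (i := i)).comp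
      (Subgroup.subgroupOfEquivOfLe (h.le i)).symm.toMonoidHom)
  refine isInternalFreeProduct_of_hom ?_ (Φ.comp (Subgroup.subtype ⊤)) ?_
  · apply Subgroup.map_injective J.subtype_injective
    rw [Subgroup.map_iSup]
    rw [← MonoidHom.range_eq_map, Subgroup.range_subtype, ← h.2]
    exact iSup_congr fun i => Subgroup.map_subgroupOf_eq_of_le (h.2 ▸ h.le i)
  · rintro i ⟨x, hxJ⟩ hx hJ
    exact hΦ i x hx hxJ

theorem isInternalFreeProduct_option_map {G' : Type*} [Group G'] {K : Subgroup G}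
    {H : ι → Subgroup G} {J : Subgroup G}
    (h : IsInternalFreeProduct (fun o : Option ι => o.elim K H) J) (f : G →* G')
    (hf : Function.Injective f) :
    IsInternalFreeProduct (fun o : Option ι => o.elim (K.map f) fun i => (H i).map f)
      (J.map f) := by
  convert h.map f hf using 2 with o
  cases o <;> rfl

/-- In a free product all factors outside a subfamily may be merged into one. -/
theorem IsInternalFreeProduct.exists_merge {B : κ → Subgroup G} {J : Subgroup G}
    (h : IsInternalFreeProduct B J) (e : ι → κ) (he : Function.Injective e) :
    ∃ K, IsInternalFreeProduct (fun o : Option ι => o.elim K fun i => B (e i)) J := by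
  have hle {s} (hs : s ∉ Set.range e) : B s ≤ ⨆ s : {s // s ∉ Set.range e}, B s :=
    le_iSup (fun s : {s // s ∉ Set.range e} => B s) ⟨s, hs⟩
  have hKJ : ⨆ s : {s // s ∉ Set.range e}, B s ≤ J := iSup_le fun s => h.le s
  refine ⟨⨆ s : {s // s ∉ Set.range e}, B s, isInternalFreeProduct_option
    hKJ (fun i => h.le _) ?_ ?_⟩
  · rw [← h.2]
    refine iSup_le fun s => ?_
    by_cases hs : s ∈ Set.range e
    · obtain ⟨i, rfl⟩ := hs
      exact le_sup_of_le_right (le_iSup (fun i => B (e i)) i)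
    · exact le_sup_of_le_left (hle hs)
  · intro N _ f fK
    have key (s) : ∃ f' : B s →* N, (∀ i, e i = s → ∀ x (hx : x ∈ B s) (hx' : x ∈ B (e i)),
        f' ⟨x, hx⟩ = f i ⟨x, hx'⟩) ∧ (s ∉ Set.range e → ∀ x (hx : x ∈ B s) hx',
        f' ⟨x, hx⟩ = fK ⟨x, hx'⟩) := by
      by_cases hs : s ∈ Set.range e
      · obtain ⟨i, rfl⟩ := hs
        refine ⟨f i, fun j hj x hx hx' => ?_, fun hs => absurd ⟨i, rfl⟩ hs⟩
        obtain rfl := he hj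
        rfl
      · exact ⟨fK.comp (Subgroup.inclusion (hle hs)), fun i hi => absurd ⟨i, hi⟩ hs,
          fun _ x hx hx' => rfl⟩
    choose f' hf1 hf2 using key
    obtain ⟨Φ, hΦ⟩ := h.exists_extension f'
    refine ⟨Φ, fun i x hx hJ => ?_, fun x hx hJ => ?_⟩
    · rw [hΦ (e i) x hx hJ]
      exact hf1 _ i rfl x hx hx
    -- The equalizer of two homomorphisms is a subgroup, so agreement on the generating subgroups
    -- gives agreement on their supremum.
    · let E := (Φ.comp (Subgroup.inclusion hKJ)).eqLocus fK
      have hE : (⨆ s : {s // s ∉ Set.range e}, B s) ≤ E.map (Subgroup.subtype _) :=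
        iSup_le fun s y hy => ⟨⟨y, hle s.2 hy⟩,
          (hΦ s.1 y hy _).trans (hf2 s.1 s.2 y hy _), rfl⟩
      obtain ⟨y, hy, rfl⟩ := hE hx
      exact hy

/-- Free products may be refined by decomposing the factors. -/
theorem IsInternalFreeProduct.trans {K : Subgroup G} {H : ι → Subgroup G} {J : Subgroup G}
    (h : IsInternalFreeProduct (fun o : Option ι => o.elim K H) J) {π : κ → ι}
    {M : κ → Subgroup G} {K' : ι → Subgroup G}
    (h' : ∀ i, IsInternalFreeProduct
      (fun o : Option {k // π k = i} => o.elim (K' i) fun k => M k) (H i)) :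
    IsInternalFreeProduct (fun o : Option κ => o.elim (K ⊔ ⨆ i, K' i) M) J := by
  have hK : K ≤ J := h.le none
  have hH (i) : H i ≤ J := h.le (some i)
  have hK' (i) : K' i ≤ H i := (h' i).le none
  have hM (k) : M k ≤ H (π k) := (h' (π k)).le (some ⟨k, rfl⟩)
  have hKJ : K ⊔ ⨆ i, K' i ≤ J := sup_le hK (iSup_le fun i => (hK' i).trans (hH i))
  refine isInternalFreeProduct_option hKJ (fun k => (hM k).trans (hH _)) ?_ ?_
  · rw [← h.2, iSup_option]
    refine sup_le (le_sup_of_le_left le_sup_left) (iSup_le fun i => ?_)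
    change H i ≤ _
    rw [← (h' i).2, iSup_option]
    exact sup_le (le_sup_of_le_left (le_sup_of_le_right (le_iSup K' i)))
      (iSup_le fun k => le_sup_of_le_right (le_iSup M k.1))
  · intro N _ f fK
    choose φ hφ1 hφ2 using fun i => (h' i).exists_extension_option (fun k => f k.1)
      (fK.comp (Subgroup.inclusion ((le_iSup K' i).trans le_sup_right)))
    obtain ⟨Φ, h1, h2⟩ := h.exists_extension_option φ (fK.comp (Subgroup.inclusion le_sup_left))
    refine ⟨Φ, fun k x hx hJ => ?_, fun x hx hJ => ?_⟩
    · rw [h1 (π k) x (hM k hx) hJ]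
      exact hφ1 (π k) ⟨k, rfl⟩ x hx _
    · let E := (Φ.comp (Subgroup.inclusion hKJ)).eqLocus fK
      have hE : (K ⊔ ⨆ i, K' i) ≤ E.map (Subgroup.subtype _) := by
        refine sup_le (fun y hy => ?_) (iSup_le fun i y hy => ?_)
        · exact ⟨⟨y, le_sup_left (a := K) hy⟩, h2 y hy _, rfl⟩
        · exact ⟨⟨y, le_sup_right (a := K) (le_iSup K' i hy)⟩,
            (h1 i y (hK' i hy) _).trans (hφ2 i y hy _), rfl⟩
      obtain ⟨y, hy, rfl⟩ := hE hx
      exact hy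

end FreeProducts

end Subgroup

namespace Subgroup

/-! ### The Kurosh subgroup theorem, by lifting a transitive action -/

section Kurosh

universe w z x

variable {G : Type w} [Group G] {ι : Type z} {A : ι → Subgroup G} {X : Type x} [MulAction G X]

/-- The points that can be reached from `x₀` by acting with `n` elements of the subgroups `A i`. -/
def ReachableIn (A : ι → Subgroup G) (x₀ : X) : ℕ → X → Prop
  | 0, y => y = x₀
  | n + 1, y => ∃ i, ∃ a ∈ A i, ∃ z, ReachableIn A x₀ n z ∧ a • z = y

/-- Minimal representatives `r i y` of the orbits of the subgroups `A i`, elements `s i y` of `A i`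
that carry the representatives to the points of the orbits, and elements `τ y` that carry `x₀` to
`y` along a tree built from the `s i y`. -/
structure OrbitTree (A : ι → Subgroup G) (x₀ : X) where
  r : ι → X → X
  s : ι → X → G
  τ : X → G
  depth : X → ℕ
  s_mem : ∀ i y, s i y ∈ A i
  s_smul : ∀ i y, s i y • r i y = y
  r_smul : ∀ i, ∀ a ∈ A i, ∀ y, r i (a • y) = r i y
  s_rep : ∀ i y, r i y = y → s i y = 1
  τ_base : τ x₀ = 1
  exists_parent : ∀ y, y ≠ x₀ → ∃ i, depth (r i y) < depth y ∧ τ y = s i y * τ (r i y)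

theorem OrbitTree.exists_of_iSup_eq_top (hA : ⨆ i, A i = ⊤) (x₀ : X)
    (htr : ∀ y : X, ∃ g : G, g • x₀ = y) : Nonempty (OrbitTree A x₀) := by
  classical
  have hreach (y : X) : ∃ n, ReachableIn A x₀ n y := by
    obtain ⟨g, rfl⟩ := htr y
    have hg : g ∈ ⨆ i, A i := hA ▸ Subgroup.mem_top g
    have : ∀ z, (∃ n, ReachableIn A x₀ n z) → ∃ n, ReachableIn A x₀ n (g • z) := by
      refine Subgroup.iSup_induction A (C := fun g => ∀ z, (∃ n, ReachableIn A x₀ n z) →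
        ∃ n, ReachableIn A x₀ n (g • z)) hg ?_ ?_ ?_
      · rintro i a ha z ⟨n, hn⟩
        exact ⟨n + 1, i, a, ha, z, hn, rfl⟩
      · intro z hz
        rwa [one_smul]
      · intro a b ha hb z hz
        rw [mul_smul]
        exact ha _ (hb _ hz)
    exact this x₀ ⟨0, rfl⟩
  let depth (y : X) : ℕ := Nat.find (hreach y)
  have hd (y) : ReachableIn A x₀ (depth y) y := Nat.find_spec (hreach y)
  have hd' {n y} (h : ReachableIn A x₀ n y) : depth y ≤ n := Nat.find_min' _ h
  have hrep (i) (O : MulAction.orbitRel.Quotient (A i) X) : ∃ z : X,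
      (Quotient.mk _ z : MulAction.orbitRel.Quotient (A i) X) = O ∧
      ∀ y, (Quotient.mk _ y : MulAction.orbitRel.Quotient (A i) X) = O → depth z ≤ depth y := by
    obtain ⟨y₀, hy₀⟩ := Quotient.exists_rep O
    have hne : ({z | (Quotient.mk _ z : MulAction.orbitRel.Quotient (A i) X) = O} :
      Set X).Nonempty := ⟨y₀, hy₀⟩
    obtain ⟨z, hz, hmin⟩ := exists_minimalFor_of_wellFoundedLT
      (fun z => (Quotient.mk _ z : MulAction.orbitRel.Quotient (A i) X) = O) depth hne
    refine ⟨z, hz, fun y hy => ?_⟩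
    rcases le_total (depth z) (depth y) with h | h
    · exact h
    · exact hmin hy h
  choose ρ hρ1 hρ2 using hrep
  let r (i : ι) (y : X) : X := ρ i (Quotient.mk _ y)
  have hr_smul (i) (a) (ha : a ∈ A i) (y) : r i (a • y) = r i y := by
    refine congrArg (ρ i) (Quotient.sound ?_)
    exact ⟨⟨a, ha⟩, rfl⟩
  have hs (i y) : ∃ s ∈ A i, s • r i y = y ∧ (r i y = y → s = 1) := by
    by_cases h : r i y = y
    · exact ⟨1, one_mem _, by rw [one_smul, h], fun _ => rfl⟩
    · obtain ⟨⟨a, ha⟩, ha'⟩ := Quotient.exact (hρ1 i (Quotient.mk _ y)).symm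
      exact ⟨a, ha, ha', fun h' => absurd h' h⟩
  choose s hs1 hs2 hs3 using hs
  -- The last move of a shortest path to `y` stays in one `A i`-orbit and starts closer to `x₀`; the
  -- representative of that orbit is at least as close.
  have hparent (y) (hy : y ≠ x₀) : ∃ i, depth (r i y) < depth y := by
    have h := hd y
    rcases hn : depth y with _ | n
    · rw [hn] at h
      exact absurd h hy
    · rw [hn] at h
      obtain ⟨i, a, ha, z, hz, rfl⟩ := h
      refine ⟨i, Nat.lt_succ_of_le ((hρ2 i _ z ?_).trans (hd' hz))⟩
      refine Quotient.sound ⟨⟨a⁻¹, inv_mem ha⟩, ?_⟩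
      exact inv_smul_smul a z
  choose par hpar using hparent
  let τ : X → G := WellFounded.fix (measure depth).wf fun y ih =>
    if h : y = x₀ then 1 else s (par y h) y * ih (r (par y h) y) (hpar y h)
  have hτ (y) : τ y = if h : y = x₀ then 1 else s (par y h) y * τ (r (par y h) y) :=
    WellFounded.fix_eq _ _ _
  exact ⟨⟨r, s, τ, depth, hs1, hs2, hr_smul, hs3, by simp [hτ x₀],
    fun y hy => ⟨par y hy, hpar y hy, by rw [hτ, dif_neg hy]⟩⟩⟩

namespace OrbitTree

variable {x₀ : X} (T : OrbitTree A x₀)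

theorem τ_smul (y : X) : T.τ y • x₀ = y := by
  induction h : T.depth y using Nat.strong_induction_on generalizing y with
  | _ n ih =>
    by_cases hy : y = x₀
    · rw [hy, T.τ_base, one_smul]
    · obtain ⟨i, hi, hτ⟩ := T.exists_parent y hy
      rw [hτ, mul_smul, ih _ (h ▸ hi) _ rfl, T.s_smul]

theorem r_r (i : ι) (y : X) : T.r i (T.r i y) = T.r i y := by
  conv_rhs => rw [← T.s_smul i y]
  rw [T.r_smul i _ (T.s_mem i y)]

theorem τ_inv_smul (y : X) : (T.τ y)⁻¹ • y = x₀ := by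
  rw [inv_smul_eq_iff, T.τ_smul]

/-- The element of the stabilizer of `x₀` that goes to `r i y`, then to `y`, and back. -/
def κ (i : ι) (y : X) : G := (T.τ y)⁻¹ * T.s i y * T.τ (T.r i y)

/-- The subgroup generated by the elements `κ i y`. -/
def κGroup : Subgroup G := Subgroup.closure {g | ∃ i y, T.κ i y = g}

theorem κ_mem (i : ι) (y : X) : T.κ i y ∈ T.κGroup := Subgroup.subset_closure ⟨i, y, rfl⟩

/-- The index set of the vertex factors. -/
abbrev Rep : Type _ := {p : ι × X // T.r p.1 p.2 = p.2}

/-- The vertex factor of an orbit: the conjugate of the stabilizer of its representative. -/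
def factor (p : T.Rep) : Subgroup G :=
  conjBy (T.τ p.1.2)⁻¹ (A p.1.1) ⊓ MulAction.stabilizer G x₀

theorem κ_smul (i : ι) (y : X) : T.κ i y • x₀ = x₀ := by
  rw [κ, mul_smul, mul_smul, T.τ_smul, T.s_smul, T.τ_inv_smul]

theorem κGroup_le : T.κGroup ≤ MulAction.stabilizer G x₀ := by
  rw [κGroup, Subgroup.closure_le]
  rintro _ ⟨i, y, rfl⟩
  exact T.κ_smul i y

theorem conj_mem_factor {i : ι} {a : G} (ha : a ∈ A i) (y : X) :
    (T.τ (T.r i y))⁻¹ * ((T.s i (a • y))⁻¹ * a * T.s i y) * T.τ (T.r i y) ∈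
      T.factor ⟨(i, T.r i y), T.r_r i y⟩ := by
  refine ⟨MultiCoreGraph.mem_conjBy.2 ?_, ?_⟩
  · have : (T.s i (a • y))⁻¹ * a * T.s i y ∈ A i :=
      mul_mem (mul_mem (inv_mem (T.s_mem _ _)) ha) (T.s_mem _ _)
    simpa [mul_assoc] using this
  · change _ ∈ MulAction.stabilizer G x₀
    rw [MulAction.mem_stabilizer_iff, mul_smul, T.τ_smul, mul_smul, mul_smul, T.s_smul, mul_smul]
    rw [inv_smul_eq_iff, T.τ_smul, inv_smul_eq_iff, ← T.r_smul i a ha y, T.s_smul]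

/-- Reidemeister–Schreier rewriting: `(τ (g • y))⁻¹ * g * τ y` is multiplicative along products, and
for `g` in `A i` it is `κ i (g • y)` times a factor element times `(κ i y)⁻¹`. At `y = x₀` it is `g`
when `g` fixes `x₀`. -/
theorem stabilizer_le (hA : ⨆ i, A i = ⊤) :
    MulAction.stabilizer G x₀ ≤ T.κGroup ⊔ ⨆ p, T.factor p := by
  set M := T.κGroup ⊔ ⨆ p, T.factor p
  have hκ (i y) : T.κ i y ∈ M := le_sup_left (a := T.κGroup) (T.κ_mem i y)
  have hf (p) : T.factor p ≤ M := le_sup_of_le_right (le_iSup T.factor p)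
  intro g hg
  have hg' : g ∈ ⨆ i, A i := hA ▸ Subgroup.mem_top g
  have : ∀ y, (T.τ (g • y))⁻¹ * g * T.τ y ∈ M := by
    refine Subgroup.iSup_induction A
      (C := fun g => ∀ y, (T.τ (g • y))⁻¹ * g * T.τ y ∈ M) hg' ?_ ?_ ?_
    · intro i a ha y
      have h := mul_mem (mul_mem (hκ i (a • y)) (hf _ (T.conj_mem_factor ha y)))
        (inv_mem (hκ i y))
      simpa [κ, mul_assoc, T.r_smul i a ha y] using h
    · intro y
      simp
    · intro a b ha hb y
      have h := mul_mem (ha (b • y)) (hb y)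
      simpa [mul_assoc, mul_smul] using h
  have h := this x₀
  rw [MulAction.mem_stabilizer_iff.1 hg, T.τ_base] at h
  simpa using h

variable {N : Type*} [Group N]

/-- Homomorphisms on the vertex factors and on `κGroup` yield an action of each `A i` on `X × N` that
lifts the action on `X` and commutes with the right multiplications. -/
theorem exists_lift (f : ∀ p, T.factor p →* N) (fK : T.κGroup →* N) (i : ι) :
    ∃ φ : A i →* Function.End (X × N),
      (∀ a p, φ a p = (a.1 • p.1, (φ a (p.1, 1)).2 * p.2)) ∧
      (∀ y, φ ⟨T.s i y, T.s_mem i y⟩ (T.r i y, 1) = (y, fK ⟨T.κ i y, T.κ_mem i y⟩)) ∧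
      ∀ (p : T.Rep) (_ : p.1.1 = i) (a : G) (ha : a ∈ A i)
        (hb : (T.τ p.1.2)⁻¹ * a * T.τ p.1.2 ∈ T.factor p),
        φ ⟨a, ha⟩ (p.1.2, 1) = (p.1.2, f p ⟨_, hb⟩) := by
  let k (y : X) : N := fK ⟨T.κ i y, T.κ_mem i y⟩
  have hk (y) (hy : T.r i y = y) : k y = 1 := by
    have : (⟨T.κ i y, T.κ_mem i y⟩ : T.κGroup) = 1 := by
      ext
      simp [κ, hy, T.s_rep i y hy]
    exact (congrArg fK this).trans (map_one fK)
  let F (a : A i) (y : X) : N := f _ ⟨_, T.conj_mem_factor a.2 y⟩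
  have hF1 (y) : F 1 y = 1 := by
    refine Eq.trans (congrArg (f _) (Subtype.ext ?_)) (map_one _)
    simp
  have hFmul (a b : A i) (y) : F (a * b) y = F a (b.1 • y) * F b y := by
    have hr := T.r_smul i b.1 b.2 y
    -- `a` acts at `b • y`, whose representative equals that of `y` only propositionally;
    -- generalizing it to `z` lets the factors be identified.
    have key : ∀ (z : X) (hz : z = T.r i y) (hz' : T.r i z = z)
        (hm : (T.τ z)⁻¹ * ((T.s i (a.1 • b.1 • y))⁻¹ * a * T.s i (b.1 • y)) * T.τ z ∈
          T.factor ⟨(i, z), hz'⟩),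
        F (a * b) y = f ⟨(i, z), hz'⟩ ⟨_, hm⟩ * F b y := by
      rintro _ rfl hz' hm
      rw [← map_mul]
      refine congrArg (f _) (Subtype.ext ?_)
      simp [mul_assoc, mul_smul]
    exact key _ hr (T.r_r i _) (T.conj_mem_factor a.2 (b.1 • y))
  -- The cocycle of the lifted action: go from `y` back to the orbit representative, act there
  -- through its stabilizer, and go forward to `a • y`.
  let c (a : A i) (y : X) : N := k (a.1 • y) * F a y * (k y)⁻¹
  let φ : A i →* Function.End (X × N) :=
    { toFun := fun a p => (a.1 • p.1, c a p.1 * p.2)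
      map_one' := by
        funext p
        change ((1 : G) • p.1, c 1 p.1 * p.2) = p
        simp [c, hF1]
      map_mul' := by
        intro a b
        funext p
        change ((a.1 * b.1) • p.1, c (a * b) p.1 * p.2) =
          (a.1 • b.1 • p.1, c a (b.1 • p.1) * (c b p.1 * p.2))
        simp [c, hFmul, mul_smul, mul_assoc] }
  have hφ (a p) : φ a p = (a.1 • p.1, c a p.1 * p.2) := rfl
  refine ⟨φ, fun a p => by simp [hφ], fun y => ?_, ?_⟩
  · rw [hφ]
    have hFs : F ⟨T.s i y, T.s_mem i y⟩ (T.r i y) = 1 := by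
      refine Eq.trans (congrArg (f _) (Subtype.ext ?_)) (map_one _)
      simp [T.s_smul, T.s_rep i _ (T.r_r i y)]
    simp only [c, hFs, T.s_smul, hk _ (T.r_r i y)]
    simp [k]
  · rintro ⟨⟨j, y⟩, hy⟩ hp a ha hb
    obtain rfl : j = i := hp
    simp only at hb hy
    have hay : a • y = y := by
      have := MulAction.mem_stabilizer_iff.1 hb.2
      rwa [mul_smul, mul_smul, inv_smul_eq_iff, T.τ_smul] at this
    rw [hφ]
    simp only [hay, c, hk y hy, mul_one, one_mul, inv_one, Prod.mk.injEq, true_and]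
    have key : ∀ (z : X) (hz : z = y) (hz' : T.r j z = z)
        (hm : (T.τ z)⁻¹ * ((T.s j (a • y))⁻¹ * a * T.s j y) * T.τ z ∈
          T.factor ⟨(j, z), hz'⟩),
        f ⟨(j, z), hz'⟩ ⟨_, hm⟩ = f ⟨(j, y), hy⟩ ⟨_, hb⟩ := by
      rintro _ rfl hz' hm
      refine congrArg (f _) (Subtype.ext ?_)
      simp [hay, T.s_rep j _ hy]
    exact key _ hy (T.r_r j y) (T.conj_mem_factor ha y)

/-- The actions of the `A i` on `X × N` are arbitrary lifts of one action on `X`, and freeness of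
`G` over the `A i` combines them into an action of `G`. The stabilizer of `x₀` preserves the fiber
`N` over `x₀` and acts on it by left multiplications; this is the homomorphism to `N` that extends
`f` and `fK`. -/
theorem isInternalFreeProduct (hA : IsInternalFreeProduct A ⊤) :
    IsInternalFreeProduct (fun o : Option T.Rep => o.elim T.κGroup T.factor)
      (MulAction.stabilizer G x₀) := by
  refine isInternalFreeProduct_option T.κGroup_le (fun p => inf_le_right)
    (T.stabilizer_le hA.2) fun N _ f fK => ?_
  choose φ hφ1 hφ2 hφ3 using T.exists_lift f fK
  obtain ⟨Ψ', hΨ'⟩ := hA.exists_extension φ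
  let Ψ : G →* Function.End (X × N) := Ψ'.comp (Subgroup.topEquiv.symm.toMonoidHom)
  have hΨ (i a) (ha : a ∈ A i) : Ψ a = φ i ⟨a, ha⟩ := hΨ' i a ha _
  have hequiv (g : G) : ∀ p, Ψ g p = (g • p.1, (Ψ g (p.1, 1)).2 * p.2) := by
    have hg : g ∈ ⨆ i, A i := hA.2 ▸ Subgroup.mem_top g
    refine Subgroup.iSup_induction A
      (C := fun g => ∀ p, Ψ g p = (g • p.1, (Ψ g (p.1, 1)).2 * p.2)) hg ?_ ?_ ?_
    · intro i a ha p
      rw [hΨ i a ha]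
      exact hφ1 i ⟨a, ha⟩ p
    · intro p
      rw [map_one]
      change p = ((1 : G) • p.1, 1 * p.2)
      simp
    · intro a b ha hb p
      have hmul (q) : Ψ (a * b) q = Ψ a (Ψ b q) := by rw [map_mul]; rfl
      obtain ⟨m, hm⟩ : ∃ m, Ψ b (p.1, 1) = (b • p.1, m) := ⟨_, by rw [hb]⟩
      have h1 : Ψ b p = (b • p.1, m * p.2) := by rw [hb p, hm]
      rw [hmul, hmul, h1, hm, ha (b • p.1, m * p.2), ha (b • p.1, m)]
      simp [mul_smul, mul_assoc]
  have hmul (a b q) : Ψ (a * b) q = Ψ a (Ψ b q) := by rw [map_mul]; rfl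
  -- Along the tree the lifted action moves only the first coordinate, because `κ` is trivial on the
  -- edge from a point to its parent.
  have hτ (y : X) : Ψ (T.τ y) (x₀, 1) = (y, 1) := by
    induction h : T.depth y using Nat.strong_induction_on generalizing y with
    | _ n ih =>
      by_cases hy : y = x₀
      · rw [hy, T.τ_base, map_one]
        rfl
      · obtain ⟨i, hi, hτ⟩ := T.exists_parent y hy
        rw [hτ, hmul, ih _ (h ▸ hi) _ rfl, hΨ i _ (T.s_mem i y), hφ2]
        have : (⟨T.κ i y, T.κ_mem i y⟩ : T.κGroup) = 1 := by
          ext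
          simp [κ, hτ]
        rw [this, map_one]
  have hτinv (y : X) (m : N) : Ψ (T.τ y)⁻¹ (y, m) = (x₀, m) := by
    have h1 : Ψ (T.τ y) (x₀, m) = (y, m) := by
      rw [hequiv, hτ]
      simp [T.τ_smul]
    rw [← h1, ← hmul, inv_mul_cancel, map_one]
    rfl
  let Φ : MulAction.stabilizer G x₀ →* N :=
    { toFun := fun g => (Ψ g (x₀, 1)).2
      map_one' := by
        rw [OneMemClass.coe_one, map_one]
        rfl
      map_mul' := by
        rintro ⟨a, ha⟩ ⟨b, hb⟩
        change (Ψ (a * b) (x₀, 1)).2 = _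
        rw [hmul, hequiv b, MulAction.mem_stabilizer_iff.1 hb, hequiv a] }
  have hΦ (g) (hg : g ∈ MulAction.stabilizer G x₀) : Φ ⟨g, hg⟩ = (Ψ g (x₀, 1)).2 := rfl
  refine ⟨Φ, fun p b hb hb' => ?_, fun b hb hb' => ?_⟩
  · have hb1 := MultiCoreGraph.mem_conjBy.1 hb.1
    rw [inv_inv] at hb1
    obtain ⟨a, ha, rfl⟩ : ∃ a ∈ A p.1.1, (T.τ p.1.2)⁻¹ * a * T.τ p.1.2 = b :=
      ⟨_, hb1, by simp [mul_assoc]⟩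
    rw [hΦ, hmul, hτ, hmul, hΨ _ _ ha, hφ3 _ p rfl a ha hb, hτinv]
  · let E := (Φ.comp (Subgroup.inclusion T.κGroup_le)).eqLocus fK
    have hE : T.κGroup ≤ E.map (Subgroup.subtype _) := by
      conv_lhs => rw [κGroup]
      rw [Subgroup.closure_le]
      rintro _ ⟨i, y, rfl⟩
      refine ⟨⟨T.κ i y, T.κ_mem i y⟩, ?_, rfl⟩
      change (Ψ ((T.τ y)⁻¹ * T.s i y * T.τ (T.r i y)) (x₀, 1)).2 = _
      rw [hmul, hτ, hmul, hΨ i _ (T.s_mem i y), hφ2, hτinv]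
    obtain ⟨c, hc, rfl⟩ := hE hb
    exact hc

end OrbitTree

/-- The Kurosh subgroup theorem for a subgroup `J'` of a free product `J`. -/
theorem IsInternalFreeProduct.exists_kurosh {J J' : Subgroup G} (hA : IsInternalFreeProduct A J)
    (hJ : J' ≤ J) : ∃ (σ : Type (max w z)) (i : σ → ι) (t : σ → G) (K : Subgroup G),
      IsInternalFreeProduct (fun o : Option σ => o.elim K fun s => conjBy (t s) (A (i s)) ⊓ J') J' ∧
      ∀ j, ∀ g ∈ J, ∃ s, i s = j ∧ ∃ h ∈ J', ∃ a ∈ A j, t s = h * g * a := by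
  obtain ⟨T⟩ := OrbitTree.exists_of_iSup_eq_top hA.subgroupOf.2
    ((1 : J) : J ⧸ J'.subgroupOf J) fun y => by
      obtain ⟨g, rfl⟩ := QuotientGroup.mk_surjective y
      exact ⟨g, by rw [MulAction.Quotient.smul_coe]; simp⟩
  have h := isInternalFreeProduct_option_map (T.isInternalFreeProduct hA.subgroupOf) J.subtype
    J.subtype_injective
  rw [MulAction.stabilizer_quotient, Subgroup.map_subgroupOf_eq_of_le hJ] at h
  refine ⟨T.Rep, fun p => p.1.1, fun p => ((T.τ p.1.2)⁻¹ : J),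
    T.κGroup.map J.subtype, ?_, ?_⟩
  · convert h using 4 with o s
    ext g
    constructor
    · rintro ⟨h1, h2⟩
      have h3 := MultiCoreGraph.mem_conjBy.1 h1
      refine ⟨⟨g, hJ h2⟩, ⟨MultiCoreGraph.mem_conjBy.2 (Subgroup.mem_subgroupOf.2 h3), ?_⟩, rfl⟩
      rw [MulAction.stabilizer_quotient]
      exact h2
    · rintro ⟨⟨g, hg⟩, ⟨h1, h2⟩, rfl⟩
      rw [MulAction.stabilizer_quotient] at h2
      have h3 := MultiCoreGraph.mem_conjBy.1 (show (⟨g, hg⟩ : J) ∈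
        conjBy (T.τ s.1.2)⁻¹ ((A s.1.1).subgroupOf J) from h1)
      exact ⟨MultiCoreGraph.mem_conjBy.2 h3, h2⟩
  · intro j g hg
    -- The double coset of `g` corresponds to the `A j`-orbit of the coset of `g⁻¹`; the inverse
    -- appears because `t` is the inverse of `τ`.
    let y : J ⧸ J'.subgroupOf J := ((⟨g, hg⟩ : J)⁻¹ : J)
    refine ⟨⟨(j, T.r j y), T.r_r j y⟩, rfl, ?_⟩
    have h1 := T.s_smul j y
    rw [← T.τ_smul (T.r j y), ← mul_smul, MulAction.Quotient.smul_coe] at h1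
    have h2 := QuotientGroup.eq.1 h1.symm
    refine ⟨_, inv_mem (Subgroup.mem_subgroupOf.1 h2), _,
      Subgroup.mem_subgroupOf.1 (T.s_mem j y), ?_⟩
    simp [mul_assoc]

end Kurosh

end Subgroup

namespace MultiCoreGraph

/-! ### Free morphisms and their composition -/

section FreeMorphisms

variable {B : Type v} {Γ Δ S : MultiCoreGraph.{u} B}

theorem conjBy_conjBy {G : Type*} [Group G] (g h : G) (H : Subgroup G) :
    Subgroup.conjBy g (Subgroup.conjBy h H) = Subgroup.conjBy (g * h) H := by
  ext x
  simp [mem_conjBy, mul_assoc]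

/-- The conjugators `j c` are spelled by closed walks at `p`, so they can be absorbed into the
connecting walks `u c`. -/
theorem isFree_iff {η : Γ ⟶ Δ} : IsFree η ↔
    ∀ p : Δ.V, ∃ (a : {c : Γ.Component // mapComponent η c = Δ.component p} → Γ.V)
      (u : {c : Γ.Component // mapComponent η c = Δ.component p} → FreeGroup B)
      (K : Subgroup (FreeGroup B)),
      (∀ c, Γ.component (a c) = c.1) ∧ (∀ c, Δ.Reads p (u c) (η.onV (a c))) ∧
      Subgroup.IsInternalFreeProduct
        (fun o : Option {c : Γ.Component // mapComponent η c = Δ.component p} =>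
          o.elim K fun c => Subgroup.conjBy (u c) (Γ.piOne (a c))) (Δ.piOne p) := by
  constructor
  · intro h p
    obtain ⟨a, u, ha, hu, j, K, hj, -, hf⟩ := h p
    refine ⟨a, fun c => j c * u c, K, ha, fun c => (mem_piOne.1 (hj c)).trans (hu c), ?_⟩
    simpa only [conjBy_conjBy] using hf
  · intro h p
    obtain ⟨a, u, K, ha, hu, hf⟩ := h p
    refine ⟨a, u, ha, hu, fun _ => 1, K, fun _ => one_mem _, hf.le none, ?_⟩
    simpa only [conjBy_conjBy, one_mul] using hf

theorem mapComponent_comp (φ : Γ ⟶ S) (ψ : S ⟶ Δ) (c : Γ.Component) :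
    mapComponent (φ ≫ ψ) c = mapComponent ψ (mapComponent φ c) := by
  obtain ⟨a, rfl⟩ := exists_component_eq c
  rfl

theorem IsFree.comp {φ : Γ ⟶ S} {ψ : S ⟶ Δ} (hφ : IsFree φ) (hψ : IsFree ψ) :
    IsFree (φ ≫ ψ) := by
  rw [isFree_iff] at *
  intro p
  obtain ⟨a, u, K, ha, hu, hf⟩ := hψ p
  choose a' u' K' ha' hu' hf' using fun c => hφ (a c)
  let π (e : {e : Γ.Component // mapComponent (φ ≫ ψ) e = Δ.component p}) :
      {c : S.Component // mapComponent ψ c = Δ.component p} :=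
    ⟨mapComponent φ e.1, (mapComponent_comp φ ψ e.1).symm.trans e.2⟩
  let ε (c) (e : {e // π e = c}) : {d : Γ.Component // mapComponent φ d = S.component (a c)} :=
    ⟨e.1.1, (congrArg Subtype.val e.2).trans (ha c).symm⟩
  have hε (c) : Function.Injective (ε c) := fun e e' h => by
    apply Subtype.ext
    apply Subtype.ext
    exact congrArg (fun d => d.1) h
  -- Conjugation by `u c` moves the decomposition of `piOne (a c)` onto the factor belonging to `c`.
  -- Merging along `ε c` reindexes it by the components of `Γ` over `c`.
  choose K'' hK'' using fun c => (Subgroup.isInternalFreeProduct_option_map (hf' c)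
    (MulAut.conj (u c)).toMonoidHom (MulAut.conj (u c)).injective).exists_merge
      (fun e => some (ε c e)) ((Option.some_injective _).comp (hε c))
  refine ⟨fun e => a' (π e) (ε (π e) ⟨e, rfl⟩), fun e => u (π e) * u' (π e) (ε (π e) ⟨e, rfl⟩),
    K ⊔ ⨆ c, K'' c, fun e => ha' _ _, fun e => (hu _).trans ((hu' _ _).map ψ), ?_⟩
  refine Subgroup.IsInternalFreeProduct.trans hf (π := π) (K' := K'') fun c => ?_
  convert hK'' c using 3 with o
  · funext e
    obtain ⟨e, rfl⟩ := e
    exact (conjBy_conjBy _ _ _).symm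
  · rfl

end FreeMorphisms

/-! ### Pullbacks of multi core graphs and of free morphisms -/

section Pullback

variable {B : Type v} {Γ Δ Δ' : MultiCoreGraph.{u} B}

/-- The darts of the fiber product of `Γ` and `Δ'` that lie in a set of darts in which every dart
can be continued without backtracking; they make up the core of the fiber product. -/
def CoreDart (Γ Δ' : MultiCoreGraph.{u} B) (x : Γ.V × Δ'.V) (l : B × Bool) : Prop :=
  ∃ C : Γ.V × Δ'.V → B × Bool → Prop, C x l ∧ ∀ y m, C y m → ∃ z, Γ.Step y.1 m z.1 ∧
    Δ'.Step y.2 m z.2 ∧ C z (m.1, !m.2) ∧ ∃ n, n ≠ (m.1, !m.2) ∧ C z n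

theorem CoreDart.exists_next {x : Γ.V × Δ'.V} {l : B × Bool} (h : CoreDart Γ Δ' x l) :
    ∃ z, Γ.Step x.1 l z.1 ∧ Δ'.Step x.2 l z.2 ∧ CoreDart Γ Δ' z (l.1, !l.2) ∧
      ∃ n, n ≠ (l.1, !l.2) ∧ CoreDart Γ Δ' z n := by
  obtain ⟨C, hx, hC⟩ := h
  obtain ⟨z, h1, h2, h3, n, h4, h5⟩ := hC x l hx
  exact ⟨z, h1, h2, ⟨C, h3, hC⟩, n, h4, C, h5, hC⟩

theorem CoreDart.flip {x z : Γ.V × Δ'.V} {l : B × Bool} (h : CoreDart Γ Δ' x l)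
    (h1 : Γ.Step x.1 l z.1) (h2 : Δ'.Step x.2 l z.2) : CoreDart Γ Δ' z (l.1, !l.2) := by
  obtain ⟨w, h1', h2', h3, -⟩ := h.exists_next
  have : w = z := Prod.ext (h1'.unique h1) (h2'.unique h2)
  exact this ▸ h3

theorem CoreDart.exists_other {x : Γ.V × Δ'.V} {l : B × Bool} (h : CoreDart Γ Δ' x l)
    (m : B × Bool) : ∃ n, n ≠ m ∧ CoreDart Γ Δ' x n := by
  by_cases hm : l = m
  · subst hm
    obtain ⟨z, h1, h2, h3, -⟩ := h.exists_next
    obtain ⟨w, h1', h2', -, n, hn, hn'⟩ := h3.exists_next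
    have : w = x := Prod.ext (h1'.unique h1.flip) (h2'.unique h2.flip)
    subst this
    exact ⟨n, by simpa using hn, hn'⟩
  · exact ⟨l, hm, h⟩

/-- Reduced walks in the fiber product between vertices of the core stay in the core. -/
theorem coreDart_of_walk {x y : Γ.V × Δ'.V} {L : List (B × Bool)} (hL : FreeGroup.IsReduced L)
    (hx : ∃ l, CoreDart Γ Δ' x l) (hy : ∃ l, CoreDart Γ Δ' y l) (h1 : Γ.Walk x.1 L y.1)
    (h2 : Δ'.Walk x.2 L y.2) {l : B × Bool} {M : List (B × Bool)} (hM : L = l :: M) :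
    CoreDart Γ Δ' x l := by
  -- The darts on reduced walks between core vertices are closed under reversal and continuation, so
  -- they lie in the core.
  let C (z : Γ.V × Δ'.V) (l : B × Bool) : Prop :=
    ∃ (x y w : Γ.V × Δ'.V) (L M : List (B × Bool)), (∃ l, CoreDart Γ Δ' x l) ∧
      (∃ l, CoreDart Γ Δ' y l) ∧ FreeGroup.IsReduced (L ++ l :: M) ∧
      Γ.Walk x.1 L z.1 ∧ Δ'.Walk x.2 L z.2 ∧ Γ.Step z.1 l w.1 ∧ Δ'.Step z.2 l w.2 ∧
      Γ.Walk w.1 M y.1 ∧ Δ'.Walk w.2 M y.2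
  subst hM
  obtain ⟨w1, hs1, hw1⟩ := h1
  obtain ⟨w2, hs2, hw2⟩ := h2
  refine ⟨C, ⟨x, y, (w1, w2), [], M, hx, hy, hL, rfl, rfl, hs1, hs2, hw1, hw2⟩, ?_⟩
  rintro z l ⟨x, y, w, L, M, hx, hy, hr, h1, h2, h3, h4, h5, h6⟩
  refine ⟨w, h3, h4, ⟨y, x, z, FreeGroup.invRev M, FreeGroup.invRev L, hy, hx, ?_, h5.symm,
    h6.symm, h3.flip, h4.flip, h1.symm, h2.symm⟩, ?_⟩
  · classical
    have := congrArg FreeGroup.invRev hr.reduce_eq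
    rw [← FreeGroup.reduce_invRev] at this
    have := FreeGroup.IsReduced.of_reduce_eq this
    simpa [FreeGroup.invRev] using this
  -- At the end of the walk, continue with a core dart that does not backtrack, itself a reduced
  -- walk of length one between core vertices; otherwise take the next letter.
  · rcases M with _ | ⟨n, M⟩
    · obtain rfl : w = y := Prod.ext h5 h6
      obtain ⟨m, hm⟩ := hy
      obtain ⟨n, hn, hn'⟩ := hm.exists_other (l.1, !l.2)
      obtain ⟨z', h1', h2', h3', -⟩ := hn'.exists_next
      exact ⟨n, hn, w, z', z', [], [], ⟨n, hn'⟩, ⟨_, h3'⟩, FreeGroup.IsReduced.singleton, rfl, rfl,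
        h1', h2', rfl, rfl⟩
    · obtain ⟨c1, hs1, hw1⟩ := h5
      obtain ⟨c2, hs2, hw2⟩ := h6
      refine ⟨n, ?_, x, y, (c1, c2), L ++ [l], M, hx, hy, by simpa using hr,
        h1.append h3.walk, h2.append h4.walk, hs1, hs2, hw1, hw2⟩
      have h7 := hr.infix ⟨L, M, by simp⟩ (L₁ := [l, n])
      rw [FreeGroup.isReduced_cons_cons] at h7
      rintro rfl
      simpa using h7.1

theorem two_le_card_of_ne {α L : Type*} [Finite α] (f : α → L) {l n : L} (h : n ≠ l)
    (hf : ∀ m, m = l ∨ m = n → ∃ a, f a = m) : 2 ≤ Nat.card α := by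
  obtain ⟨a, rfl⟩ := hf l (Or.inl rfl)
  obtain ⟨b, rfl⟩ := hf n (Or.inr rfl)
  exact Finite.one_lt_card_iff_nontrivial.2 ⟨b, a, fun hab => h (congrArg f hab)⟩

/-- The pullback of multi core graphs: the core of the fiber product of graphs. -/
def pullback (η : Γ ⟶ Δ) (β : Δ' ⟶ Δ) : MultiCoreGraph.{u} B where
  V := {x : Γ.V × Δ'.V // η.onV x.1 = β.onV x.2 ∧ ∃ l, CoreDart Γ Δ' x l}
  E := {e : Γ.E × Δ'.E // η.onE e.1 = β.onE e.2 ∧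
    CoreDart Γ Δ' (Γ.src e.1, Δ'.src e.2) (Γ.label e.1, true)}
  finite_V := by
    have := Γ.finite_V
    have := Δ'.finite_V
    infer_instance
  finite_E := by
    have := Γ.finite_E
    have := Δ'.finite_E
    infer_instance
  src e := ⟨(Γ.src e.1.1, Δ'.src e.1.2), by
    rw [← η.src_comm, ← β.src_comm, e.2.1], _, e.2.2⟩
  tgt e := ⟨(Γ.tgt e.1.1, Δ'.tgt e.1.2), by
    rw [← η.tgt_comm, ← β.tgt_comm, e.2.1], (Γ.label e.1.1, false),
    e.2.2.flip ⟨e.1.1, rfl, rfl, rfl⟩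
      ⟨e.1.2, by rw [← β.label_comm, ← e.2.1, η.label_comm], rfl, rfl⟩⟩
  label e := Γ.label e.1.1
  out_unique := by
    rintro ⟨⟨e, f⟩, h, hc⟩ ⟨⟨e', f'⟩, h', hc'⟩ hs hl
    simp only [Subtype.mk.injEq, Prod.mk.injEq] at hs hl ⊢
    refine ⟨Γ.out_unique _ _ hs.1 hl, Δ'.out_unique _ _ hs.2 ?_⟩
    rw [← β.label_comm, ← β.label_comm, ← h, ← h', η.label_comm, η.label_comm, hl]
  in_unique := by
    rintro ⟨⟨e, f⟩, h, hc⟩ ⟨⟨e', f'⟩, h', hc'⟩ hs hl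
    simp only [Subtype.mk.injEq, Prod.mk.injEq] at hs hl ⊢
    refine ⟨Γ.in_unique _ _ hs.1 hl, Δ'.in_unique _ _ hs.2 ?_⟩
    rw [← β.label_comm, ← β.label_comm, ← h, ← h', η.label_comm, η.label_comm, hl]
  two_le_degree := by
    rintro ⟨x, hx, l, hl⟩
    have := Γ.finite_E
    have := Δ'.finite_E
    rw [← Nat.card_sum]
    obtain ⟨n, hn, hn'⟩ := hl.exists_other l
    have key (l) (hl : CoreDart Γ Δ' x l) : ∃ e : Γ.E × Δ'.E, Γ.label e.1 = l.1 ∧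
        (η.onE e.1 = β.onE e.2 ∧
          CoreDart Γ Δ' (Γ.src e.1, Δ'.src e.2) (Γ.label e.1, true)) ∧
        (l.2 = true → (Γ.src e.1, Δ'.src e.2) = x) ∧
        (l.2 = false → (Γ.tgt e.1, Δ'.tgt e.2) = x) := by
      obtain ⟨z, ⟨e, h1, h2, h3⟩, ⟨e', h1', h2', h3'⟩, h4, -⟩ := hl.exists_next
      obtain ⟨b, s⟩ := l
      have hlab : Δ.label (η.onE e) = Δ.label (β.onE e') := by
        rw [η.label_comm, β.label_comm, h1, h1']
      cases s
      · simp only [Bool.false_eq_true, if_false, Bool.not_false] at *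
        refine ⟨(e, e'), h1, ⟨Δ.in_unique _ _ ?_ hlab, ?_⟩, nofun, fun _ => Prod.ext h3 h3'⟩
        · rw [η.tgt_comm, β.tgt_comm, h3, h3', hx]
        · simp only [h1, h2, h2']
          exact h4
      · simp only [if_true] at *
        refine ⟨(e, e'), h1, ⟨Δ.out_unique _ _ ?_ hlab, ?_⟩, fun _ => Prod.ext h2 h2', nofun⟩
        · rw [η.src_comm, β.src_comm, h2, h2', hx]
        · simp only [h1, h2, h2']
          exact hl
    refine two_le_card_of_ne (Sum.elim (fun e => (Γ.label e.1.1.1, true))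
      fun e => (Γ.label e.1.1.1, false)) hn fun m hm => ?_
    obtain ⟨e, h1, h2, h3, h4⟩ := key m (by rcases hm with rfl | rfl <;> assumption)
    obtain ⟨b, _ | _⟩ := m
    · exact ⟨Sum.inr ⟨⟨e, h2⟩, Subtype.ext (h4 rfl)⟩, Prod.ext h1 rfl⟩
    · exact ⟨Sum.inl ⟨⟨e, h2⟩, Subtype.ext (h3 rfl)⟩, Prod.ext h1 rfl⟩

variable {η : Γ ⟶ Δ} {β : Δ' ⟶ Δ}

/-- The first projection of the pullback. -/
def pullbackFst (η : Γ ⟶ Δ) (β : Δ' ⟶ Δ) : pullback η β ⟶ Γ where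
  onV x := x.1.1
  onE e := e.1.1
  src_comm _ := rfl
  tgt_comm _ := rfl
  label_comm _ := rfl

/-- The second projection of the pullback. -/
def pullbackSnd (η : Γ ⟶ Δ) (β : Δ' ⟶ Δ) : pullback η β ⟶ Δ' where
  onV x := x.1.2
  onE e := e.1.2
  src_comm _ := rfl
  tgt_comm _ := rfl
  label_comm e := by
    change Δ'.label e.1.2 = Γ.label e.1.1
    rw [← β.label_comm, ← e.2.1, η.label_comm]

theorem pullback_condition (η : Γ ⟶ Δ) (β : Δ' ⟶ Δ) :
    pullbackFst η β ≫ η = pullbackSnd η β ≫ β :=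
  Hom.ext (funext fun x => x.2.1) (funext fun e => e.2.1)

/-- The image of `T` in the fiber product lies in the core, since every dart of `T` can be continued
without backtracking. -/
theorem pullback_exists_lift {T : MultiCoreGraph.{u} B} (f : T ⟶ Γ) (g : T ⟶ Δ')
    (h : f ≫ η = g ≫ β) :
    ∃ l : T ⟶ pullback η β, l ≫ pullbackFst η β = f ∧ l ≫ pullbackSnd η β = g := by
  have hV (a) : η.onV (f.onV a) = β.onV (g.onV a) := congrFun (congrArg Hom.onV h) a
  have hE (e) : η.onE (f.onE e) = β.onE (g.onE e) := congrFun (congrArg Hom.onE h) e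
  have hstep {a b : T.V} {l} (hs : T.Step a l b) : CoreDart Γ Δ' (f.onV a, g.onV a) l := by
    refine ⟨fun x l => ∃ a b, T.Step a l b ∧ x = (f.onV a, g.onV a), ⟨a, b, hs, rfl⟩, ?_⟩
    rintro _ l ⟨a, b, hs, rfl⟩
    refine ⟨(f.onV b, g.onV b), hs.map f, hs.map g, ⟨b, a, hs.flip, rfl⟩, ?_⟩
    obtain ⟨n, hn, c, hc⟩ := exists_step_ne b (l.1, !l.2)
    exact ⟨n, hn, b, c, hc, rfl⟩
  refine ⟨⟨fun a => ⟨(f.onV a, g.onV a), hV a, ?_⟩, fun e => ⟨(f.onE e, g.onE e), hE e, ?_⟩,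
    fun e => Subtype.ext (Prod.ext (f.src_comm e) (g.src_comm e)),
    fun e => Subtype.ext (Prod.ext (f.tgt_comm e) (g.tgt_comm e)),
    fun e => f.label_comm e⟩, rfl, rfl⟩
  · obtain ⟨l, b, hs⟩ := exists_step a
    exact ⟨l, hstep hs⟩
  · have h1 := hstep (a := T.src e) (l := (T.label e, true)) ⟨e, rfl, rfl, rfl⟩
    simp only [f.src_comm, g.src_comm, f.label_comm]
    exact h1

theorem pullback_step {x y : (pullback η β).V} {l : B × Bool} (hc : CoreDart Γ Δ' x.1 l)
    (h1 : Γ.Step x.1.1 l y.1.1) (h2 : Δ'.Step x.1.2 l y.1.2) : (pullback η β).Step x l y := by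
  have hf := hc.flip (z := y.1) h1 h2
  obtain ⟨b, s⟩ := l
  obtain ⟨e, hl, hs, ht⟩ := h1
  obtain ⟨e', hl', hs', ht'⟩ := h2
  have hlab : Δ.label (η.onE e) = Δ.label (β.onE e') := by
    rw [η.label_comm, β.label_comm, hl, hl']
  cases s
  · simp only [Bool.false_eq_true, if_false, Bool.not_false] at *
    refine ⟨⟨(e, e'), Δ.in_unique _ _ ?_ hlab, ?_⟩, hl, ?_, ?_⟩
    · rw [η.tgt_comm, β.tgt_comm, ht, ht', x.2.1]
    · simp only [hl, hs, hs']
      exact hf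
    · exact Subtype.ext (Prod.ext hs hs')
    · exact Subtype.ext (Prod.ext ht ht')
  · simp only [if_true] at *
    refine ⟨⟨(e, e'), Δ.out_unique _ _ ?_ hlab, ?_⟩, hl, ?_, ?_⟩
    · rw [η.src_comm, β.src_comm, hs, hs', x.2.1]
    · simp only [hl, hs, hs']
      exact hc
    · exact Subtype.ext (Prod.ext hs hs')
    · exact Subtype.ext (Prod.ext ht ht')

theorem pullback_walk {x y : (pullback η β).V} {L : List (B × Bool)}
    (hL : FreeGroup.IsReduced L) (h1 : Γ.Walk x.1.1 L y.1.1) (h2 : Δ'.Walk x.1.2 L y.1.2) :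
    (pullback η β).Walk x L y := by
  induction L generalizing x with
  | nil => exact Subtype.ext (Prod.ext h1 h2)
  | cons l L ih =>
    have hc := coreDart_of_walk hL x.2.2 y.2.2 h1 h2 rfl
    obtain ⟨c, hs, hw⟩ := h1
    obtain ⟨d, hs', hw'⟩ := h2
    have hV : η.onV c = β.onV d := by
      have h1 := hs.map η
      have h2 := hs'.map β
      rw [x.2.1] at h1
      exact h1.unique h2
    let z : (pullback η β).V := ⟨(c, d), hV, _, hc.flip (z := (c, d)) hs hs'⟩
    exact ⟨z, pullback_step hc hs hs', ih (hL.infix ⟨[l], [], by simp⟩) hw hw'⟩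

/-- Reading the reduced word of `g` in both graphs gives a walk in the fiber product, which stays in
the core because its endpoints do. For `x = y` this makes `piOne` of the pullback an intersection.
-/
theorem pullback_reads_iff {x y : (pullback η β).V} {g : FreeGroup B} :
    (pullback η β).Reads x g y ↔ Γ.Reads x.1.1 g y.1.1 ∧ Δ'.Reads x.1.2 g y.1.2 := by
  classical
  refine ⟨fun h => ⟨h.map (pullbackFst η β), h.map (pullbackSnd η β)⟩, fun ⟨h1, h2⟩ => ?_⟩
  have := (pullback_walk (FreeGroup.isReduced_toWord (x := g)) h1.walk_toWord h2.walk_toWord).reads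
  rwa [FreeGroup.mk_toWord] at this

/-- Free morphisms are stable under pullback. -/
theorem IsFree.pullbackSnd (hη : IsFree η) (β : Δ' ⟶ Δ) :
    IsFree (pullbackSnd η β) := by
  rw [isFree_iff] at *
  intro p
  obtain ⟨a, u, K, ha, hu, hf⟩ := hη (β.onV p)
  have hle : Δ'.piOne p ≤ Δ.piOne (β.onV p) := fun g hg => Reads.map β hg
  obtain ⟨σ, i, t, K', hK, hσ⟩ := hf.exists_kurosh hle
  have key (C : {c : (pullback η β).Component //
      mapComponent (MultiCoreGraph.pullbackSnd η β) c = Δ'.component p}) :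
      ∃ (s : σ) (c : _) (x : (pullback η β).V) (w : FreeGroup B) (z : FreeGroup B),
        i s = some c ∧ (pullback η β).component x = C.1 ∧ Δ'.Reads p w x.1.2 ∧
        Γ.Reads (a c) z x.1.1 ∧ t s = w * z⁻¹ * (u c)⁻¹ := by
    obtain ⟨C, hC⟩ := C
    obtain ⟨x, rfl⟩ := exists_component_eq C
    obtain ⟨w₀, hw₀⟩ := component_eq_iff.1 hC.symm
    have hw₀ : Δ'.Reads p w₀ x.1.2 := hw₀
    let c : {c : Γ.Component // mapComponent η c = Δ.component (β.onV p)} :=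
      ⟨Γ.component x.1.1, by
        rw [mapComponent_component, eq_comm, component_eq_iff, x.2.1]
        exact ⟨w₀, hw₀.map β⟩⟩
    obtain ⟨z₀, hz₀⟩ := component_eq_iff.1 (ha c)
    have hg : w₀ * z₀⁻¹ * (u c)⁻¹ ∈ Δ.piOne (β.onV p) := by
      have h1 := hw₀.map β
      rw [← x.2.1] at h1
      exact (h1.trans (hz₀.symm.map η)).trans (hu c).symm
    -- Kurosh represents the double coset of this element by some `t s`. The discrepancies `h` and
    -- `b` are spelled by closed walks, in `Δ'` at `p` and, after conjugation, in `Γ` at `a c`, and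
    -- are absorbed into `w` and `z`.
    obtain ⟨s, hs, h, hh, b, hb, ht⟩ := hσ (some c) _ hg
    have hb := mem_conjBy.1 hb
    refine ⟨s, c, x, h * w₀, ((u c)⁻¹ * b * u c)⁻¹ * z₀, hs, rfl, hh.trans hw₀,
      (Reads.symm hb).trans hz₀, ?_⟩
    rw [ht]
    group
  choose s c x w z hs hx hw hz ht using key
  -- If two components use the same Kurosh factor, one element is spelled between their base
  -- vertices in both `Γ` and `Δ'`, hence in the pullback.
  have hinj : Function.Injective s := by
    intro C C' h
    have hc : c C = c C' := Option.some_injective _ (by rw [← hs, ← hs, h])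
    have h1 := ht C
    rw [h, ht C', hc] at h1
    have h2 : (w C')⁻¹ * w C = (z C')⁻¹ * z C := by
      have h3 := mul_right_cancel h1
      rw [inv_mul_eq_iff_eq_mul, ← mul_assoc, h3]
      group
    have h3 : (pullback η β).Reads (x C') ((w C')⁻¹ * w C) (x C) := by
      refine pullback_reads_iff.2 ⟨?_, (hw C').symm.trans (hw C)⟩
      rw [h2]
      exact (hz C').symm.trans (hc ▸ hz C)
    apply Subtype.ext
    rw [← hx, ← hx]
    exact (component_eq_iff.2 ⟨_, h3⟩).symm
  -- Kurosh factors not hit by `s` go into the complement, so surjectivity of `s` is not needed.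
  obtain ⟨K'', hK''⟩ := hK.exists_merge (fun C => some (s C)) ((Option.some_injective _).comp hinj)
  refine ⟨x, w, K'', hx, hw, ?_⟩
  convert hK'' using 3 with o
  funext C
  ext g
  simp only [Option.elim_some, hs, Subgroup.mem_inf, mem_conjBy, ht, mem_piOne, pullback_reads_iff]
  refine and_congr ⟨fun h => ?_, fun h => ?_⟩ ⟨fun h => ?_, fun h => ?_⟩
  · have := ((hz C).trans h).trans (hz C).symm
    simpa [mul_assoc] using this
  · have := ((hz C).symm.trans h).trans (hz C)
    simpa [mul_assoc] using this
  · have := ((hw C).trans h).trans (hw C).symm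
    simpa [mul_assoc] using this
  · have := ((hw C).symm.trans h).trans (hw C)
    simpa [mul_assoc] using this

end Pullback

end MultiCoreGraph

namespace Subgroup

/-! ### Rank via homomorphisms to the group of order two -/

section HomRank

universe w z

/-- The binary logarithm of the number of homomorphisms from `J` to the group of order two. For a
free group of finite rank this is the rank. -/
noncomputable def homRank {G : Type w} [Group G] (J : Subgroup G) : ℕ :=
  Nat.log 2 (Nat.card (J →* Multiplicative (ZMod 2)))

variable {G : Type w} [Group G] {ι : Type z}

theorem finite_hom_of_fg {J : Subgroup G} (hJ : J.FG) :
    Finite (J →* Multiplicative (ZMod 2)) := by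
  obtain ⟨S, hS, hfin⟩ := (Group.fg_iff (G := J)).1 ((Group.fg_iff_subgroup_fg J).2 hJ)
  have := hfin.to_subtype
  have : Finite (Multiplicative (ZMod 2)) := inferInstanceAs (Finite (ZMod 2))
  refine Finite.of_injective (fun (f : J →* Multiplicative (ZMod 2)) (s : S) => f s) ?_
  intro f g h
  exact MonoidHom.eq_of_eqOn_dense hS fun s hs => congrFun h ⟨s, hs⟩

theorem homRank_conjBy (g : G) (H : Subgroup G) : (conjBy g H).homRank = H.homRank := by
  have e : H ≃* conjBy g H := H.equivMapOfInjective _ (MulAut.conj g).injective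
  rw [homRank, homRank]
  exact congrArg _ (Nat.card_congr e.symm.monoidHomCongrLeftEquiv)

theorem IsInternalFreeProduct.restrict_surjective {H : ι → Subgroup G} {J : Subgroup G}
    (h : IsInternalFreeProduct H J) (N : Type*) [Monoid N] :
    Function.Surjective fun (f : J →* N) (i : ι) => f.comp (Subgroup.inclusion (h.le i)) := by
  intro f
  obtain ⟨Φ, hΦ⟩ := h.exists_extension f
  exact ⟨Φ, funext fun i => MonoidHom.ext fun x => hΦ i x x.2 _⟩

theorem IsInternalFreeProduct.finite_hom {H : ι → Subgroup G} {J : Subgroup G}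
    (h : IsInternalFreeProduct H J) (hJ : J.FG) (i : ι) :
    Finite (H i →* Multiplicative (ZMod 2)) := by
  have := finite_hom_of_fg hJ
  have := Finite.of_surjective _ (h.restrict_surjective (Multiplicative (ZMod 2)))
  exact Finite.of_surjective _
    (Function.surjective_eval (β := fun i => H i →* Multiplicative (ZMod 2)) i)

/-- Homomorphisms on the factors extend jointly to `J`, so the product of their numbers is at most
the number for `J`. Rounding down in the logarithm only helps the inequality. -/
theorem IsInternalFreeProduct.sum_homRank_le [Fintype ι] {H : ι → Subgroup G} {J : Subgroup G}
    (h : IsInternalFreeProduct H J) (hJ : J.FG) : ∑ i, (H i).homRank ≤ J.homRank := by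
  have := finite_hom_of_fg hJ
  have hfin := h.finite_hom hJ
  have hle := Nat.card_le_card_of_surjective _ (h.restrict_surjective (Multiplicative (ZMod 2)))
  rw [Nat.card_pi] at hle
  refine Nat.le_log_of_pow_le one_lt_two (le_trans ?_ hle)
  rw [← Finset.prod_pow_eq_pow_sum]
  exact Finset.prod_le_prod' fun i _ => Nat.pow_log_le_self 2 Nat.card_pos.ne'

/-- By Nielsen–Schreier `J` is free, so it has a nontrivial homomorphism sending every generator to
`1`. Finiteness keeps `Nat.card` from being the default value `0`. -/
theorem homRank_pos {α : Type*} {J : Subgroup (FreeGroup α)} (hJ : J ≠ ⊥)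
    (hfin : Finite (J →* Multiplicative (ZMod 2))) : 0 < J.homRank := by
  refine Nat.log_pos one_lt_two (Finite.one_lt_card_iff_nontrivial.2 ?_)
  have hne : Nonempty (IsFreeGroup.Generators J) := by
    by_contra h
    rw [not_nonempty_iff] at h
    have : Subsingleton J := (IsFreeGroup.toFreeGroup J).injective.subsingleton
    exact hJ ((Subgroup.eq_bot_iff_forall J).2 fun x hx =>
      congrArg Subtype.val (Subsingleton.elim (⟨x, hx⟩ : J) 1))
  obtain ⟨b⟩ := hne
  refine ⟨1, IsFreeGroup.lift fun _ => Multiplicative.ofAdd 1, fun h => ?_⟩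
  have := DFunLike.congr_fun h (IsFreeGroup.of b)
  rw [IsFreeGroup.lift_of] at this
  exact absurd this.symm (show (1 : ZMod 2) ≠ 0 by decide)

end HomRank

end Subgroup

namespace MultiCoreGraph

/-! ### The weight of a graph and its behavior along free morphisms -/

section Weight

variable {B : Type v} {Γ Δ : MultiCoreGraph.{u} B}

instance (Γ : MultiCoreGraph.{u} B) : Finite Γ.Component :=
  have := Γ.finite_V
  inferInstanceAs (Finite (Quotient Γ.connSetoid))

noncomputable instance (Γ : MultiCoreGraph.{u} B) : Fintype Γ.Component := Fintype.ofFinite _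

noncomputable instance (Γ : MultiCoreGraph.{u} B) : DecidableEq Γ.Component := Classical.decEq _

theorem piOne_fg (a : Γ.V) : (Γ.piOne a).FG := by
  classical
  have := Γ.finite_E
  have ht (v : Γ.V) : ∃ t, (v = a → t = 1) ∧ ((∃ g, Γ.Reads a g v) → Γ.Reads a t v) := by
    by_cases hv : v = a
    · exact ⟨1, fun _ => rfl, fun _ => hv ▸ Reads.nil⟩
    · by_cases h : ∃ g, Γ.Reads a g v
      · exact ⟨h.choose, fun h' => absurd h' hv, fun _ => h.choose_spec⟩
      · exact ⟨1, fun _ => rfl, fun h' => absurd h' h⟩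
  choose t ht1 ht2 using ht
  let γ (e : Γ.E) : FreeGroup B := t (Γ.src e) * FreeGroup.of (Γ.label e) * (t (Γ.tgt e))⁻¹
  -- Only edges in the component of `a` are used: elsewhere `t` has the default value `1`, and `γ e`
  -- need not lie in `piOne a`.
  let T : Set (FreeGroup B) := γ '' {e | ∃ g, Γ.Reads a g (Γ.src e)}
  have key {g v} (h : Γ.Reads a g v) : g * (t v)⁻¹ ∈ Subgroup.closure T := by
    induction h with
    | nil => simp [ht1 a rfl]
    | forward e h ih =>
      have h1 : γ e ∈ Subgroup.closure T := Subgroup.subset_closure ⟨e, ⟨_, h⟩, rfl⟩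
      simpa [γ, mul_assoc] using mul_mem ih h1
    | backward e h ih =>
      have h1 : γ e ∈ Subgroup.closure T := Subgroup.subset_closure ⟨e, ⟨_, h.backward e⟩, rfl⟩
      simpa [γ, mul_assoc] using mul_mem ih (inv_mem h1)
  refine (Subgroup.fg_iff _).2 ⟨T, le_antisymm ?_ fun g hg => ?_, Set.toFinite T⟩
  · rw [Subgroup.closure_le]
    rintro _ ⟨e, ⟨g, hg⟩, rfl⟩
    exact ((ht2 _ ⟨g, hg⟩).forward e).trans (ht2 _ ⟨_, hg.forward e⟩).symm
  · simpa [ht1 a rfl] using key hg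

theorem piOne_eq_conjBy {a b : Γ.V} {g : FreeGroup B} (h : Γ.Reads a g b) :
    Γ.piOne a = Subgroup.conjBy g (Γ.piOne b) := by
  ext x
  rw [mem_conjBy_piOne, mem_piOne]
  constructor
  · intro hx
    exact (h.symm.trans hx).trans h
  · intro hx
    simpa [mul_assoc] using (h.trans hx).trans h.symm

/-- The rank of the fundamental group of a component. -/
noncomputable def compRank (c : Γ.Component) : ℕ :=
  Quotient.lift (fun a => (Γ.piOne a).homRank) (fun a b h' => by
    obtain ⟨g, h⟩ := h'
    simp only [piOne_eq_conjBy h, Subgroup.homRank_conjBy]) c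

theorem compRank_component (a : Γ.V) : compRank (Γ.component a) = (Γ.piOne a).homRank := rfl

theorem compRank_pos (c : Γ.Component) : 0 < compRank c := by
  obtain ⟨a, rfl⟩ := exists_component_eq c
  exact Subgroup.homRank_pos (piOne_ne_bot a) (Subgroup.finite_hom_of_fg (piOne_fg a))

/-- A measure of the size of a multi core graph that decreases along free morphisms. -/
noncomputable def weight (Γ : MultiCoreGraph.{u} B) : ℕ := ∑ c : Γ.Component, (2 * compRank c - 1)

/-- The weights over the component sum to twice the total rank minus the number of components, and
the total rank together with that of `K` is bounded by the rank below. An empty fiber is strictly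
lighter because ranks are positive; in the equality case there is one component and `K` has rank
zero, hence is trivial. -/
theorem IsFree.fiber {η : Γ ⟶ Δ} (h : IsFree η) (p : Δ.V) :
    (∑ c : {c : Γ.Component // mapComponent η c = Δ.component p}, (2 * compRank c.1 - 1)) ≤
      2 * compRank (Δ.component p) - 1 ∧
    (2 * compRank (Δ.component p) - 1 ≤
      (∑ c : {c : Γ.Component // mapComponent η c = Δ.component p}, (2 * compRank c.1 - 1)) →
      Subsingleton {c : Γ.Component // mapComponent η c = Δ.component p} ∧
      ∃ a u, Δ.Reads p u (η.onV a) ∧ Δ.piOne p = Subgroup.conjBy u (Γ.piOne a)) := by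
  obtain ⟨a, u, K, ha, hu, hf⟩ := isFree_iff.1 h p
  have h1 := hf.sum_homRank_le (piOne_fg p)
  rw [Fintype.sum_option] at h1
  simp only [Option.elim_none, Option.elim_some, Subgroup.homRank_conjBy, ← compRank_component,
    ha] at h1
  have h2 : (∑ c : {c : Γ.Component // mapComponent η c = Δ.component p}, (2 * compRank c.1 - 1)) +
      Fintype.card {c : Γ.Component // mapComponent η c = Δ.component p} =
      2 * ∑ c : {c : Γ.Component // mapComponent η c = Δ.component p}, compRank c.1 := by
    rw [Finset.mul_sum, Fintype.card_eq_sum_ones, ← Finset.sum_add_distrib]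
    exact Finset.sum_congr rfl fun c _ => by have := compRank_pos c.1; omega
  have h3 := compRank_pos (Δ.component p)
  have h4 : Fintype.card {c : Γ.Component // mapComponent η c = Δ.component p} = 0 →
      (∑ c : {c : Γ.Component // mapComponent η c = Δ.component p}, (2 * compRank c.1 - 1)) = 0 := by
    intro h
    rw [Fintype.card_eq_zero_iff] at h
    exact Fintype.sum_empty _
  refine ⟨by omega, fun h5 => ?_⟩
  have hcard : Fintype.card {c : Γ.Component // mapComponent η c = Δ.component p} = 1 := by omega
  have hsub : Subsingleton {c : Γ.Component // mapComponent η c = Δ.component p} :=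
    Fintype.card_le_one_iff_subsingleton.1 hcard.le
  have hK : K = ⊥ := by
    by_contra hK
    have := Subgroup.homRank_pos hK (hf.finite_hom (piOne_fg p) none)
    omega
  obtain ⟨c, hc⟩ := Fintype.card_eq_one_iff.1 hcard
  refine ⟨hsub, a c, u c, hu c, ?_⟩
  rw [← hf.2, iSup_option]
  refine le_antisymm (sup_le ?_ (iSup_le fun c' => ?_)) ?_
  · simp [hK]
  · rw [hc c']
    exact le_rfl
  · exact le_sup_of_le_right
      (le_iSup (fun c => Subgroup.conjBy (u c) (Γ.piOne (a c))) c)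

theorem isIso_of_bijective (η : Γ ⟶ Δ) (hV : Function.Bijective η.onV)
    (hE : Function.Bijective η.onE) : IsIso η := by
  let eV := Equiv.ofBijective _ hV
  let eE := Equiv.ofBijective _ hE
  have hV' (x) : η.onV (eV.symm x) = x := eV.apply_symm_apply x
  have hE' (x) : η.onE (eE.symm x) = x := eE.apply_symm_apply x
  refine ⟨⟨eV.symm, eE.symm, fun e => ?_, fun e => ?_, fun e => ?_⟩, ?_, ?_⟩
  · apply hV.1
    rw [hV', ← η.src_comm, hE']
  · apply hV.1
    rw [hV', ← η.tgt_comm, hE']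
  · rw [← η.label_comm, hE']
  · exact Hom.ext (funext eV.symm_apply_apply) (funext eE.symm_apply_apply)
  · exact Hom.ext (funext hV') (funext hE')

/-- A morphism that is bijective on components and on fundamental groups is an isomorphism. -/
theorem isIso_of_piOne_eq (η : Γ ⟶ Δ)
    (hη : ∀ p, Subsingleton {c : Γ.Component // mapComponent η c = Δ.component p} ∧
      ∃ a u, Δ.Reads p u (η.onV a) ∧ Δ.piOne p = Subgroup.conjBy u (Γ.piOne a)) : IsIso η := by
  have hcomp {b b' : Γ.V} {g} (h : Δ.Reads (η.onV b) g (η.onV b')) :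
      Γ.component b = Γ.component b' := by
    have := (hη (η.onV b)).1
    have := Subsingleton.elim
      (⟨Γ.component b, rfl⟩ : {c : Γ.Component // mapComponent η c = Δ.component (η.onV b)})
      ⟨Γ.component b', (component_eq_iff.2 ⟨g, h⟩).symm⟩
    exact congrArg Subtype.val this
  have hpi {b : Γ.V} {g} (h : Δ.Reads (η.onV b) g (η.onV b)) : Γ.Reads b g b := by
    obtain ⟨-, a, u, hu, heq⟩ := hη (η.onV b)
    obtain ⟨w, hw⟩ := component_eq_iff.1 (hcomp hu)
    have h1 : u * w⁻¹ ∈ Δ.piOne (η.onV b) := hu.trans (hw.map η).symm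
    have h2 : g ∈ Δ.piOne (η.onV b) := h
    -- Since `u * w⁻¹` is in `piOne` below, `w⁻¹ * u` is spelled at `a` in `Γ`; so `u` itself leads
    -- from `b` to `a` in `Γ`.
    rw [heq, mem_conjBy_piOne] at h1 h2
    have h3 := hw.trans h1
    simp only [inv_mul_cancel_left, mul_inv_cancel_left] at h3
    simpa [mul_assoc] using (h3.trans h2).trans h3.symm
  have hstep {b : Γ.V} {l q} (h : Δ.Step (η.onV b) l q) : ∃ c, Γ.Step b l c ∧ η.onV c = q := by
    -- To lift an edge, extend it to a reduced closed walk, lift that by equality of fundamental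
    -- groups, and keep its first step.
    obtain ⟨L, hL, hw⟩ := h.exists_closed_walk
    obtain ⟨c, hc, -⟩ := (hpi hw.reads).walk hL
    exact ⟨c, hc, (hc.map η).unique h⟩
  have hwalk {L} : ∀ {b : Γ.V} {q}, Δ.Walk (η.onV b) L q → ∃ c, η.onV c = q := by
    induction L with
    | nil => exact fun {b q} h => ⟨b, h⟩
    | cons l L ih =>
      rintro b q ⟨d, hd, hw⟩
      obtain ⟨c, -, rfl⟩ := hstep hd
      exact ih hw
  have hV : Function.Bijective η.onV := by
    refine ⟨fun b b' h => ?_, fun p => ?_⟩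
    · obtain ⟨w, hw⟩ := component_eq_iff.1 (hcomp (b := b) (b' := b') (by rw [h]; exact Reads.nil))
      have h1 := hw.map η
      rw [← h] at h1
      exact (hpi h1).unique hw
    · obtain ⟨-, a, u, hu, -⟩ := hη p
      obtain ⟨L, -, hw⟩ := hu.symm.exists_walk
      exact hwalk hw
  refine isIso_of_bijective η hV ⟨fun e e' h => ?_, fun e => ?_⟩
  · refine Γ.out_unique e e' (hV.1 ?_) ?_
    · rw [← η.src_comm, ← η.src_comm, h]
    · rw [← η.label_comm, ← η.label_comm, h]
  · obtain ⟨b, hb⟩ := hV.2 (Δ.src e)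
    obtain ⟨c, ⟨e', h1, h2, -⟩, -⟩ := hstep (b := b) (l := (Δ.label e, true)) (q := Δ.tgt e)
      ⟨e, rfl, hb.symm, rfl⟩
    refine ⟨e', Δ.out_unique _ _ ?_ ((η.label_comm e').trans h1)⟩
    rw [η.src_comm, h2, ← hb]
    rfl

theorem IsFree.isIso_of_weight_le {η : Γ ⟶ Δ} (h : IsFree η) (hw : Δ.weight ≤ Γ.weight) :
    IsIso η := by
  have hsum : Γ.weight = ∑ D : Δ.Component,
      ∑ c : {c : Γ.Component // mapComponent η c = D}, (2 * compRank c.1 - 1) := by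
    rw [weight, ← (Equiv.sigmaFiberEquiv (mapComponent η)).sum_comp, Fintype.sum_sigma]
    rfl
  have hle (D : Δ.Component) : (∑ c : {c : Γ.Component // mapComponent η c = D},
      (2 * compRank c.1 - 1)) ≤ 2 * compRank D - 1 := by
    obtain ⟨p, rfl⟩ := exists_component_eq D
    exact (h.fiber p).1
  refine isIso_of_piOne_eq η fun p => (h.fiber p).2 ?_
  by_contra hlt
  have := Finset.sum_lt_sum (fun D _ => hle D)
    ⟨Δ.component p, Finset.mem_univ _, not_le.1 hlt⟩
  rw [← hsum] at this
  exact absurd this (not_lt.2 hw)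

end Weight

/-! ### Algebraic morphisms against free morphisms -/

section Decomposition

variable {B : Type v} {Γ Δ S S' : MultiCoreGraph.{u} B}

theorem isFree_id (Γ : MultiCoreGraph.{u} B) : IsFree (𝟙 Γ) := by
  rw [isFree_iff]
  intro p
  have hc (c : {c : Γ.Component // mapComponent (𝟙 Γ) c = Γ.component p}) :
      Γ.component p = c.1 := by
    obtain ⟨c, hc⟩ := c
    obtain ⟨a, rfl⟩ := exists_component_eq c
    exact hc.symm
  refine ⟨fun _ => p, fun _ => 1, ⊥, hc, fun _ => Reads.nil,
    Subgroup.isInternalFreeProduct_option bot_le (fun c x hx => ?_) (fun x hx => ?_) ?_⟩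
  · simpa [mem_piOne] using mem_conjBy_piOne.1 hx
  · refine le_sup_right (a := (⊥ : Subgroup (FreeGroup B))) (Subgroup.mem_iSup_of_mem
      ⟨Γ.component p, rfl⟩ (mem_conjBy_piOne.2 ?_))
    simpa [mem_piOne] using hx
  · intro N _ f fK
    have hle : Γ.piOne p ≤ Subgroup.conjBy 1 (Γ.piOne p) := fun x hx =>
      mem_conjBy_piOne.2 (by simpa [mem_piOne] using hx)
    refine ⟨(f ⟨Γ.component p, rfl⟩).comp (Subgroup.inclusion hle), fun c x hx hJ => ?_,
      fun x hx hJ => ?_⟩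
    · obtain rfl : c = ⟨Γ.component p, rfl⟩ := Subtype.ext (hc c).symm
      rfl
    · obtain rfl := Subgroup.mem_bot.1 hx
      exact (map_one _).trans (map_one fK).symm

theorem IsAlgebraic.isIso_pullbackSnd {φ : Γ ⟶ S} {ψ : S ⟶ Δ} {φ' : Γ ⟶ S'} {ψ' : S' ⟶ Δ}
    (h : φ ≫ ψ = φ' ≫ ψ') (hφ : IsAlgebraic φ) (hψ' : IsFree ψ') :
    IsIso (pullbackSnd ψ' ψ) := by
  obtain ⟨l, -, hl⟩ := pullback_exists_lift φ' φ h.symm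
  exact hφ _ l _ hl (hψ'.pullbackSnd ψ)

theorem IsAlgebraic.exists_hom {φ : Γ ⟶ S} {ψ : S ⟶ Δ} {φ' : Γ ⟶ S'} {ψ' : S' ⟶ Δ}
    (h : φ ≫ ψ = φ' ≫ ψ') (hφ : IsAlgebraic φ) (hψ' : IsFree ψ') :
    ∃ θ : S ⟶ S', θ ≫ ψ' = ψ ∧ φ ≫ θ = φ' := by
  have := hφ.isIso_pullbackSnd h hψ'
  obtain ⟨l, hl, hl'⟩ := pullback_exists_lift φ' φ h.symm
  refine ⟨inv (pullbackSnd ψ' ψ) ≫ pullbackFst ψ' ψ, ?_, ?_⟩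
  · rw [Category.assoc, pullback_condition, IsIso.inv_hom_id_assoc]
  · rw [← hl', Category.assoc, IsIso.hom_inv_id_assoc, hl]

/-- Maps `S ⟶ S'` over `Δ` are sections of the pullback projection to `S`, and an isomorphism has
only one section. -/
theorem IsAlgebraic.hom_unique {φ : Γ ⟶ S} {ψ : S ⟶ Δ} {φ' : Γ ⟶ S'} {ψ' : S' ⟶ Δ}
    (h : φ ≫ ψ = φ' ≫ ψ') (hφ : IsAlgebraic φ) (hψ' : IsFree ψ') {θ θ' : S ⟶ S'}
    (hθ : θ ≫ ψ' = ψ) (hθ' : θ' ≫ ψ' = ψ) : θ = θ' := by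
  have := hφ.isIso_pullbackSnd h hψ'
  have key (θ : S ⟶ S') (hθ : θ ≫ ψ' = ψ) :
      θ = inv (pullbackSnd ψ' ψ) ≫ pullbackFst ψ' ψ := by
    obtain ⟨l, rfl, hl⟩ := pullback_exists_lift θ (𝟙 S) (hθ.trans (Category.id_comp ψ).symm)
    rw [← IsIso.inv_eq_of_inv_hom_id hl]
  rw [key θ hθ, key θ' hθ']

theorem exists_algebraic_free (η : Γ ⟶ Δ) : ∃ (S : MultiCoreGraph.{u} B) (φ : Γ ⟶ S) (ψ : S ⟶ Δ),
    φ ≫ ψ = η ∧ IsAlgebraic φ ∧ IsFree ψ := by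
  -- The family is nonempty because `η` followed by the identity is such a decomposition.
  obtain ⟨S, ⟨φ, ψ, h, hψ⟩, hmin⟩ := exists_minimalFor_of_wellFoundedLT
    (fun S : MultiCoreGraph.{u} B => ∃ (φ : Γ ⟶ S) (ψ : S ⟶ Δ), φ ≫ ψ = η ∧ IsFree ψ) weight
    ⟨Δ, η, 𝟙 Δ, Category.comp_id η, isFree_id Δ⟩
  refine ⟨S, φ, ψ, h, fun S' φ' ψ' h' hψ' => hψ'.isIso_of_weight_le ?_, hψ⟩
  rcases le_total S.weight S'.weight with hw | hw
  · exact hw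
  · exact hmin ⟨φ', ψ' ≫ ψ, by rw [← Category.assoc, h', h], hψ'.comp hψ⟩ hw

end Decomposition

end MultiCoreGraph

theorem mainTheorem8 {B : Type v} [Finite B] {Γ Δ : MultiCoreGraph.{u} B} (η : Γ ⟶ Δ) :
    ∃ (S : MultiCoreGraph.{u} B) (φ : Γ ⟶ S) (ψ : S ⟶ Δ),
      φ ≫ ψ = η ∧ MultiCoreGraph.IsAlgebraic φ ∧ MultiCoreGraph.IsFree ψ ∧
      (∀ (S' : MultiCoreGraph.{u} B) (φ' : Γ ⟶ S') (ψ' : S' ⟶ Δ), φ' ≫ ψ' = η →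
        MultiCoreGraph.IsAlgebraic φ' → MultiCoreGraph.IsFree ψ' →
        ∃ i : S ≅ S', φ ≫ i.hom = φ' ∧ i.hom ≫ ψ' = ψ) ∧
      (∀ (S' : MultiCoreGraph.{u} B) (φ' : Γ ⟶ S') (ψ' : S' ⟶ Δ), φ' ≫ ψ' = η →
        MultiCoreGraph.IsAlgebraic φ' → ∃ θ : S' ⟶ S, φ' ≫ θ = φ ∧ θ ≫ ψ = ψ') ∧
      (∀ (S' : MultiCoreGraph.{u} B) (φ' : Γ ⟶ S') (ψ' : S' ⟶ Δ), φ' ≫ ψ' = η →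
        MultiCoreGraph.IsFree ψ' → ∃ θ' : S ⟶ S', θ' ≫ ψ' = ψ ∧ φ ≫ θ' = φ') := by
  obtain ⟨S, φ, ψ, h, hφ, hψ⟩ := MultiCoreGraph.exists_algebraic_free η
  refine ⟨S, φ, ψ, h, hφ, hψ, fun S' φ' ψ' h' hφ' hψ' => ?_, fun S' φ' ψ' h' hφ' => ?_,
    fun S' φ' ψ' h' hψ' => hφ.exists_hom (h.trans h'.symm) hψ'⟩
  · obtain ⟨θ, h1, h2⟩ := hφ.exists_hom (h.trans h'.symm) hψ'
    obtain ⟨θ', h3, h4⟩ := hφ'.exists_hom (h'.trans h.symm) hψ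
    refine ⟨⟨θ, θ', ?_, ?_⟩, h2, h1⟩
    · exact hφ.hom_unique rfl hψ (by rw [Category.assoc, h3, h1]) (Category.id_comp ψ)
    · exact hφ'.hom_unique rfl hψ' (by rw [Category.assoc, h1, h3]) (Category.id_comp ψ')
  · obtain ⟨θ, h1, h2⟩ := hφ'.exists_hom (h'.trans h.symm) hψ
    exact ⟨θ, h2, h1⟩
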